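/- Let $\Gamma\subset\mathbb{Q}^{+}$ be a finitely generated multiplicative group of positive rational numbers, of rank $r\ge 1$. For $k\ge1$ let $\mathbb{Q}(\zeta_k,\Gamma^{1/k})$ be the field obtained from $\mathbb{Q}$ by adjoining the $k$-th roots of unity and all $k$-th roots of all elements of $\Gamma$, let $\varphi(k)=k\prod_{\ell\mid k}(1-1/\ell)$ be Euler's function ($\ell$ prime), $\operatorname{rad}(k)$ the product of the distinct primes dividing $k$, and $\omega(k)$ the number of these primes. Then the series and the product (over all primes $p$) $$C_\Gamma=\sum_{k\ge1}\frac{\varphi(k)\,\operatorname{rad}(k)\,(-1)^{\omega(k)}}{k^{2}\,[\mathbb{Q}(\zeta_k,\Gamma^{1/k}):\mathbb{Q}]},\qquad C_r=\prod_{p}\left(1-\frac{p}{p^{r+2}-1}\right)$$ converge absolutely, and $C_\Gamma$ is a nonzero rational multiple of $C_r$, that is, $C_\Gamma=q\,C_r$ for some $q\in\mathbb{Q}$ with $q\neq0$. -/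

import Mathlib

noncomputable section

namespace KummerAverage

/-- Jordan's totient function `J_t(k) = k ^ t * ∏_{ℓ ∣ k} (1 - 1 / ℓ ^ t)`, with `ℓ` prime. -/
def jordanTotient (t k : ℕ) : ℝ :=
  (k : ℝ) ^ t * ∏ l ∈ k.primeFactors, (1 - 1 / (l : ℝ) ^ t)

/-- The radical of `k`: the product of the distinct primes dividing `k`. -/
def rad (k : ℕ) : ℕ := ∏ l ∈ k.primeFactors, l

/-- The field `ℚ(ζ_k, Γ^{1/k})`, as a subfield of `ℂ`: all `k`-th roots of unity and all `k`-th
roots of all elements of `Γ` are adjoined to `ℚ`. -/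
def kummerField (Γ : Subgroup ℚˣ) (k : ℕ) : IntermediateField ℚ ℂ :=
  IntermediateField.adjoin ℚ
    ({z : ℂ | z ^ k = 1} ∪ {z : ℂ | ∃ g ∈ Γ, z ^ k = ((g : ℚ) : ℂ)})

/-- The `k`-th term
`J_t(k) rad(k)^t (-1)^{ω(k)} / (k^{2t} [ℚ(ζ_k, Γ^{1/k}) : ℚ])` of the series `C_{Γ,t}`. -/
def seriesTerm (Γ : Subgroup ℚˣ) (t : ℕ) (k : ℕ+) : ℝ :=
  jordanTotient t k * (rad k : ℝ) ^ t * (-1) ^ (ArithmeticFunction.cardDistinctFactors (k : ℕ)) /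
    (((k : ℕ) : ℝ) ^ (2 * t) * (Module.finrank ℚ (kummerField Γ k) : ℝ))

/-- The constant `C_{Γ,t}`. -/
def constC (Γ : Subgroup ℚˣ) (t : ℕ) : ℝ := ∑' k : ℕ+, seriesTerm Γ t k

/-- The local factor `1 - p / (p ^ (r + 2) - 1)`. -/
def eulerFactor (r : ℕ) (p : Nat.Primes) : ℝ :=
  1 - ((p : ℕ) : ℝ) / (((p : ℕ) : ℝ) ^ (r + 2) - 1)

/-- The Euler product `C_r = ∏_p (1 - p / (p ^ (r + 2) - 1))`. -/
def constEuler (r : ℕ) : ℝ := ∏' p : Nat.Primes, eulerFactor r p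

end KummerAverage

end

/-! Degree formula. By Kummer theory the degree over `ℚ(ζ_k)` is the index in `Γ` of the elements
whose positive `k`-th root lies in `ℚ(ζ_k)`. Galois groups of cyclotomic fields are abelian, so such
a root is at most quadratic (`sq_rat_of_mem_cyclo`). As `Γ` is finitely generated, one modulus `N`
handles all these quadratic radicals, and the degree is `φ(k) (k/d)^r I(d)` with `d = gcd(k, N)`
(`kummerKernel_eq_map`, `exists_finrank_kummerField_eq`).

Rationality. The `k`-th term is thus `f(k) F(d)`, where `f(k) = rad(k) (-1)^{ω(k)} / k^{r+2}` is
multiplicative with Euler product `C_r`, and `F` is rational valued. Möbius inversion of `F` over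
the divisors of `N` leaves finitely many sums of `f` over multiples of `e`, each a rational multiple
of `C_r` (`multipleSum_eq_rat_mul`).

Nonvanishing. The weight `φ(k) rad(k) (-1)^{ω(k)} / k²` is the Möbius inverse of `1/n`. Hence the
sum over `k ∣ M` is the average over `σ` in the Galois group at level `M` of `1/i(σ)`, where `i(σ)`
is the largest `k ∣ M` whose field is fixed by `σ`. The `σ` with `i(σ) = 2N` have proportion bounded
below independently of `M`, so the limit is positive (`le_sum_invWeight_div`,
`tsum_invWeight_div_finrank_pos`). -/

namespace KummerAverage
open IntermediateField

/-! ### Cyclotomic fields, their intersections and their real radicals -/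

/-- The field generated over `ℚ` by the `k`-th roots of unity, as a subfield of `ℂ`. -/
noncomputable def cyclo (k : ℕ) : IntermediateField ℚ ℂ :=
  adjoin ℚ {z : ℂ | ∃ n ∈ ({k} : Set ℕ), n ≠ 0 ∧ z ^ n = 1}

instance isCyclotomicExtension_cyclo (k : ℕ) : IsCyclotomicExtension {k} ℚ (cyclo k) :=
  isCyclotomicExtension_adjoin_of_exists_isPrimitiveRoot {k} ℚ ℂ
    fun n _ hn => ⟨_, Complex.isPrimitiveRoot_exp n hn⟩

theorem mem_cyclo_of_pow_eq_one {k : ℕ} (hk : k ≠ 0) {z : ℂ} (hz : z ^ k = 1) : z ∈ cyclo k :=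
  subset_adjoin _ _ ⟨k, rfl, hk, hz⟩

theorem finrank_cyclo {k : ℕ} (hk : k ≠ 0) : Module.finrank ℚ (cyclo k) = k.totient := by
  have : NeZero k := ⟨hk⟩
  exact IsCyclotomicExtension.finrank (n := k) (cyclo k)
    (Polynomial.cyclotomic.irreducible_rat (Nat.pos_of_ne_zero hk))

theorem cyclo_mono {a b : ℕ} (hb : b ≠ 0) (h : a ∣ b) : cyclo a ≤ cyclo b := by
  refine adjoin.mono _ _ _ ?_
  rintro z ⟨n, rfl, -, hz⟩
  obtain ⟨c, rfl⟩ := h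
  exact ⟨n * c, rfl, hb, by rw [pow_mul, hz, one_pow]⟩

instance isAbelianGalois_cyclo (k : ℕ) : IsAbelianGalois ℚ (cyclo k) :=
  IsCyclotomicExtension.isAbelianGalois {k} ℚ (cyclo k)

instance finiteDimensional_cyclo (k : ℕ) : FiniteDimensional ℚ (cyclo k) :=
  IsCyclotomicExtension.finiteDimensional {k} ℚ (cyclo k)

theorem isCyclotomicExtension_restrict {a b : ℕ} (h : cyclo a ≤ cyclo b) :
    IsCyclotomicExtension {a} ℚ (restrict h) :=
  IsCyclotomicExtension.equiv {a} ℚ (cyclo a) (restrictAlgEquiv h)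

/-- Subfields correspond to groups of Dirichlet characters, the `a`-th cyclotomic field to the
conductors dividing `a`; a conductor dividing `a` and `b` divides their gcd. -/
theorem inf_le_of_isCyclotomicExtension {K : Type*} [Field K] [NumberField K] {a b n : ℕ}
    [NeZero a] [NeZero b] [NeZero n] [IsCyclotomicExtension {n} ℚ K] (ha : a ∣ n) (hb : b ∣ n)
    (A B C : IntermediateField ℚ K) [IsCyclotomicExtension {a} ℚ A]
    [IsCyclotomicExtension {b} ℚ B] [IsCyclotomicExtension {a.gcd b} ℚ C] : A ⊓ B ≤ C := by
  have : NeZero (a.gcd b) := ⟨Nat.gcd_ne_zero_left (NeZero.ne a)⟩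
  have : IsAbelianGalois ℚ K := IsCyclotomicExtension.isAbelianGalois {n} ℚ K
  have : IsGalois ℚ A := IsCyclotomicExtension.isGalois {a} ℚ _
  have : IsGalois ℚ B := IsCyclotomicExtension.isGalois {b} ℚ _
  have : IsGalois ℚ C := IsCyclotomicExtension.isGalois {a.gcd b} ℚ _
  let e := IsCyclotomicExtension.Rat.intermediateFieldEquivSubgroupChar n K ℂ
  refine e.le_iff_le.1 fun χ hχ => ?_
  rw [OrderIso.map_inf, Subgroup.mem_inf,
    IsCyclotomicExtension.Rat.mem_intermediateFieldEquivSubgroupChar_iff_conductor_dvd _ _ _ _ ha,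
    IsCyclotomicExtension.Rat.mem_intermediateFieldEquivSubgroupChar_iff_conductor_dvd _ _ _ _ hb]
    at hχ
  rw [IsCyclotomicExtension.Rat.mem_intermediateFieldEquivSubgroupChar_iff_conductor_dvd
    _ _ _ _ ((Nat.gcd_dvd_left a b).trans ha)]
  exact Nat.dvd_gcd hχ.1 hχ.2

theorem cyclo_inf_cyclo_le {a b : ℕ} (ha : a ≠ 0) (hb : b ≠ 0) :
    cyclo a ⊓ cyclo b ≤ cyclo (a.gcd b) := by
  have hn : a.lcm b ≠ 0 := Nat.lcm_ne_zero ha hb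
  have hg : a.gcd b ≠ 0 := Nat.gcd_ne_zero_left ha
  have := NeZero.mk ha
  have := NeZero.mk hb
  have := NeZero.mk hn
  have := NeZero.mk hg
  have hda : a ∣ a.lcm b := Nat.dvd_lcm_left a b
  have hdb : b ∣ a.lcm b := Nat.dvd_lcm_right a b
  have hdg : a.gcd b ∣ a.lcm b := (Nat.gcd_dvd_left a b).trans hda
  have ia := cyclo_mono hn hda
  have ib := cyclo_mono hn hdb
  have ig := cyclo_mono hn hdg
  have := isCyclotomicExtension_restrict ia
  have := isCyclotomicExtension_restrict ib
  have := isCyclotomicExtension_restrict ig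
  have : NumberField (cyclo (a.lcm b)) := { to_finiteDimensional := inferInstance }
  have key : restrict ia ⊓ restrict ib ≤ restrict ig :=
    inf_le_of_isCyclotomicExtension (n := a.lcm b) hda hdb _ _ _
  rintro x ⟨hxa, hxb⟩
  have h1 : (⟨x, ia hxa⟩ : cyclo (a.lcm b)) ∈ restrict ia ⊓ restrict ib :=
    mem_inf.2 ⟨(mem_restrict ia _).2 hxa, (mem_restrict ib _).2 hxb⟩
  exact (mem_restrict ig _).1 (key h1)

theorem star_mem_cyclo {k : ℕ} {x : ℂ} (hx : x ∈ cyclo k) : starRingEnd ℂ x ∈ cyclo k := by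
  induction hx using adjoin_induction with
  | mem x hx =>
    obtain ⟨n, rfl, hn, hx⟩ := hx
    exact mem_cyclo_of_pow_eq_one hn (by rw [← map_pow, hx, map_one])
  | algebraMap x => simp
  | add x y _ _ hx hy => rw [map_add]; exact add_mem hx hy
  | mul x y _ _ hx hy => rw [map_mul]; exact mul_mem hx hy
  | inv x _ h => rw [map_inv₀]; exact inv_mem h

/-- A positive real radical lying in a cyclotomic field is at most quadratic. -/
theorem sq_rat_of_mem_cyclo {k n : ℕ} (hk : k ≠ 0) {x : ℝ} {c : ℚ}
    (hc : x ^ k = c) (hm : (x : ℂ) ∈ cyclo n) : ∃ d : ℚ, x ^ 2 = d := by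
  let y : cyclo n := ⟨x, hm⟩
  let conj : cyclo n →ₐ[ℚ] cyclo n :=
    { toFun := fun z => ⟨starRingEnd ℂ z, star_mem_cyclo z.2⟩
      map_one' := Subtype.ext (map_one _)
      map_mul' := fun a b => Subtype.ext (map_mul _ _ _)
      map_zero' := Subtype.ext (map_zero _)
      map_add' := fun a b => Subtype.ext (map_add _ _ _)
      commutes' := fun q => Subtype.ext (by simp) }
  let τ : Gal(cyclo n/ℚ) := AlgEquiv.ofBijective conj conj.bijective
  have hτ : τ y = y := Subtype.ext (Complex.conj_ofReal x)
  -- Every `σ` commutes with complex conjugation `τ`, so `σ y` is real; having the same `k`-th power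
  -- as `y`, it is `± y`.
  have key : ∀ σ : Gal(cyclo n/ℚ), σ (y ^ 2) = y ^ 2 := by
    intro σ
    have h1 : τ (σ y) = σ y := by
      have : τ * σ = σ * τ := mul_comm' τ σ
      calc τ (σ y) = (τ * σ) y := rfl
        _ = σ (τ y) := by rw [this]; rfl
        _ = σ y := by rw [hτ]
    obtain ⟨u, hu⟩ := Complex.conj_eq_iff_real.1 (congrArg Subtype.val h1)
    have h2 : (σ y) ^ k = y ^ k := by
      have : y ^ k = algebraMap ℚ (cyclo n) c := by
        apply Subtype.ext
        simpa [y] using congrArg (fun t : ℝ => (t : ℂ)) hc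
      rw [← map_pow, this, AlgEquiv.commutes]
    have h3 : u ^ k = x ^ k := by
      have := congrArg Subtype.val h2
      simp only [SubmonoidClass.coe_pow, hu, y] at this
      exact_mod_cast this
    have h4 : |u| = |x| := by
      have : |u| ^ k = |x| ^ k := by rw [← abs_pow, ← abs_pow, h3]
      exact (pow_left_inj₀ (abs_nonneg _) (abs_nonneg _) hk).1 this
    have h5 : u ^ 2 = x ^ 2 := (sq_eq_sq_iff_abs_eq_abs _ _).2 h4
    apply Subtype.ext
    rw [map_pow]
    simp only [SubmonoidClass.coe_pow, hu, y]
    exact_mod_cast h5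
  obtain ⟨d, hd⟩ := (IsGalois.mem_range_algebraMap_iff_fixed (F := ℚ) (y ^ 2)).2 key
  refine ⟨d, ?_⟩
  have := congrArg Subtype.val hd
  simp only [SubmonoidClass.coe_pow, y] at this
  have h' : ((d : ℚ) : ℂ) = (x : ℂ) ^ 2 := by simpa using this
  exact_mod_cast h'.symm

/-- For odd `p` the quadratic Gauss sum squares to `± p`, and a factor `i` corrects the sign; for `p
= 2` take `ζ₈ + ζ₈⁻¹`. The factor 8 makes room for `i` and `ζ₈`. -/
theorem sqrt_prime_mem_cyclo {p : ℕ} (hp : p.Prime) : ((√(p : ℝ) : ℝ) : ℂ) ∈ cyclo (8 * p) := by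
  have h8 : 8 * p ≠ 0 := by have := hp.pos; positivity
  have hI : Complex.I ∈ cyclo (8 * p) := by
    refine mem_cyclo_of_pow_eq_one h8 ?_
    rw [show 8 * p = 4 * (2 * p) by ring, pow_mul, Complex.I_pow_four, one_pow]
  have hp0 : (0 : ℝ) ≤ p := Nat.cast_nonneg p
  have hsq : (((√(p : ℝ) : ℝ) : ℂ)) ^ 2 = p := by exact_mod_cast Real.sq_sqrt hp0
  have of_sq : ∀ z ∈ cyclo (8 * p), z ^ 2 = p → ((√(p : ℝ) : ℝ) : ℂ) ∈ cyclo (8 * p) := by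
    intro z hz h
    rcases sq_eq_sq_iff_eq_or_eq_neg.1 (hsq.trans h.symm) with h | h
    · exact h ▸ hz
    · exact h ▸ neg_mem hz
  rcases eq_or_ne p 2 with rfl | h2
  · have hζ := Complex.isPrimitiveRoot_exp 8 (by norm_num)
    set ζ := Complex.exp (2 * Real.pi * Complex.I / (8 : ℕ))
    have hζ0 : ζ ≠ 0 := hζ.ne_zero (by norm_num)
    have h4 : ζ ^ 4 = -1 := by
      have h := hζ.pow_eq_one
      have h' : ζ ^ 4 ≠ 1 := hζ.pow_ne_one_of_pos_of_lt (by norm_num) (by norm_num)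
      have : (ζ ^ 4 - 1) * (ζ ^ 4 + 1) = 0 := by linear_combination h
      rcases mul_eq_zero.1 this with h | h
      · exact absurd (sub_eq_zero.1 h) h'
      · linear_combination h
    have hmem : ζ ∈ cyclo (8 * 2) := mem_cyclo_of_pow_eq_one (by norm_num) (by
      rw [pow_mul, hζ.pow_eq_one, one_pow])
    refine of_sq (ζ + ζ⁻¹) (add_mem hmem (inv_mem hmem)) ?_
    field_simp
    push_cast
    linear_combination h4
  · have : Fact p.Prime := ⟨hp⟩
    have : NeZero p := ⟨hp.ne_zero⟩
    have hζ := Complex.isPrimitiveRoot_exp p hp.ne_zero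
    set ζ := Complex.exp (2 * Real.pi * Complex.I / p)
    have hmem : ζ ∈ cyclo (8 * p) := mem_cyclo_of_pow_eq_one h8 (by
      rw [mul_comm, pow_mul, hζ.pow_eq_one, one_pow])
    let χ : MulChar (ZMod p) ℂ := (quadraticChar (ZMod p)).ringHomComp (Int.castRingHom ℂ)
    let ψ : AddChar (ZMod p) ℂ := AddChar.zmodChar p hζ.pow_eq_one
    have hχ : χ ≠ 1 := (MulChar.ringHomComp_ne_one_iff (RingHom.injective_int _)).mpr
      (quadraticChar_ne_one (by rwa [ZMod.ringChar_zmod_n]))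
    have hχ2 : χ.IsQuadratic := (quadraticChar_isQuadratic (ZMod p)).comp _
    have hψ : ψ.IsPrimitive := AddChar.zmodChar_primitive_of_primitive_root p hζ
    have hg := gaussSum_sq hχ hχ2 hψ
    rw [ZMod.card] at hg
    have hgm : gaussSum χ ψ ∈ cyclo (8 * p) := by
      refine sum_mem fun a _ => mul_mem ?_ ?_
      · simp [χ]
      · rw [AddChar.zmodChar_apply]
        exact pow_mem hmem _
    rcases hχ2 (-1) with h | h | h
    · rw [h, zero_mul] at hg
      have := mul_self_eq_zero.1 ((sq _).symm.trans hg)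
      have hne := gaussSum_ne_zero_of_nontrivial (by simpa using hp.ne_zero) hχ hψ
      exact absurd this hne
    · exact of_sq _ hgm (by rw [hg, h, one_mul])
    · refine of_sq _ (mul_mem hI hgm) ?_
      rw [mul_pow, hg, h, Complex.I_sq]
      ring

theorem sqrt_nat_mem_cyclo {m : ℕ} (hm : m ≠ 0) : ((√(m : ℝ) : ℝ) : ℂ) ∈ cyclo (8 * m) := by
  induction m using Nat.recOnMul with
  | zero => exact absurd rfl hm
  | one => simp
  | prime p hp => exact sqrt_prime_mem_cyclo hp
  | mul a b ha hb =>
    obtain ⟨h1, h2⟩ := mul_ne_zero_iff.1 hm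
    have h8 : 8 * (a * b) ≠ 0 := by positivity
    rw [Nat.cast_mul, Real.sqrt_mul (Nat.cast_nonneg a), Complex.ofReal_mul]
    exact mul_mem (cyclo_mono h8 ⟨b, by ring⟩ (ha h1)) (cyclo_mono h8 ⟨a, by ring⟩ (hb h2))

theorem exists_sqrt_rat_mem_cyclo {c : ℚ} (hc : 0 < c) :
    ∃ n ≠ 0, ((√(c : ℝ) : ℝ) : ℂ) ∈ cyclo n := by
  have hnum : c.num.natAbs ≠ 0 := Int.natAbs_ne_zero.2 (Rat.num_pos.2 hc).ne'
  have h8 : 8 * (c.num.natAbs * c.den) ≠ 0 := by have := c.den_nz; positivity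
  refine ⟨8 * (c.num.natAbs * c.den), h8, ?_⟩
  have h1 : (c : ℝ) = (c.num.natAbs : ℝ) / (c.den : ℝ) := by
    rw [Nat.cast_natAbs, abs_of_pos (Rat.num_pos.2 hc)]
    exact_mod_cast (Rat.num_div_den c).symm
  rw [h1, Real.sqrt_div (Nat.cast_nonneg _), Complex.ofReal_div]
  exact div_mem (cyclo_mono h8 ⟨c.den, by ring⟩ (sqrt_nat_mem_cyclo hnum))
    (cyclo_mono h8 ⟨c.num.natAbs, by ring⟩ (sqrt_nat_mem_cyclo c.den_nz))

/-! ### Kummer degrees as indices -/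

/-- If the Galois group of `E / F` acts on the image of `ρ` through scalars in `F`, and this image
generates `E`, then the degree of `E / F` is the index of the elements mapped into `F`. -/
theorem finrank_eq_index_of_kummer {F E G : Type*} [Field F] [Field E] [Algebra F E]
    [IsGalois F E] [CommGroup G] (ρ : G →* E) (H : Subgroup G)
    (hH : ∀ g, g ∈ H ↔ ρ g ∈ Set.range (algebraMap F E))
    (hσ : ∀ (σ : Gal(E/F)) g, σ (ρ g) / ρ g ∈ Set.range (algebraMap F E))
    (htop : adjoin F (Set.range ρ) = ⊤) : Module.finrank F E = H.index := by
  have hρ0 : ∀ g, ρ g ≠ 0 := fun g h => by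
    have : ρ g * ρ g⁻¹ = 1 := by rw [← map_mul, mul_inv_cancel, map_one]
    rw [h, zero_mul] at this
    exact zero_ne_one this
  have hρinv : ∀ g, ρ g⁻¹ = (ρ g)⁻¹ := fun g => by
    refine eq_inv_of_mul_eq_one_left ?_
    rw [← map_mul, inv_mul_cancel, map_one]
  -- The Kummer cocycle is a homomorphism because its values lie in `F` and are fixed by the group.
  let χ : G → (Gal(E/F) →* E) := fun g =>
    { toFun := fun σ => σ (ρ g) / ρ g
      map_one' := div_self (hρ0 g)
      map_mul' := fun σ τ => by
        obtain ⟨a, ha⟩ := hσ τ g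
        have h1 : τ (ρ g) = algebraMap F E a * ρ g := by
          rw [ha, div_mul_cancel₀ _ (hρ0 g)]
        have := hρ0 g
        rw [AlgEquiv.mul_apply, h1, map_mul, AlgEquiv.commutes]
        field_simp }
  have hχ : ∀ g g', χ g = χ g' → g⁻¹ * g' ∈ H := by
    intro g g' h
    rw [hH, InfiniteGalois.mem_range_algebraMap_iff_fixed]
    intro σ
    have h1 : σ (ρ g) / ρ g = σ (ρ g') / ρ g' := DFunLike.congr_fun h σ
    have h0 := hρ0 g
    have h0' := hρ0 g'
    have h2 : σ (ρ g) ≠ 0 := by simpa using h0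
    rw [map_mul, hρinv, map_mul, map_inv₀]
    field_simp at h1 ⊢
    linear_combination -h1
  let v : G ⧸ H → E := fun q => ρ q.out
  have hli : LinearIndependent F v := by
    have hinj : Function.Injective fun q : G ⧸ H => χ q.out := by
      intro q q' h
      have := hχ _ _ h
      rw [← QuotientGroup.eq, QuotientGroup.out_eq', QuotientGroup.out_eq'] at this
      exact this
    -- Distinct cosets give distinct characters, so Dedekind's independence applies; a relation
    -- among the `v q` becomes one among characters after applying `σ`.
    have hE := (linearIndependent_monoidHom Gal(E/F) E).comp _ hinj
    rw [linearIndependent_iff'] at hE ⊢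
    intro s a hs q hq
    have := hE s (fun q => algebraMap F E (a q) * v q) (by
      funext σ
      have h := congrArg σ hs
      simp only [map_sum, map_zero, map_smul] at h
      simp only [Finset.sum_apply, Pi.smul_apply, Function.comp, Pi.zero_apply, ← h]
      refine Finset.sum_congr rfl fun q _ => ?_
      have := hρ0 q.out
      change algebraMap F E (a q) * ρ q.out * (σ (ρ q.out) / ρ q.out) = a q • σ (ρ q.out)
      rw [Algebra.smul_def]
      field_simp) q hq
    simpa [v, hρ0] using this
  have hspan : ⊤ ≤ Submodule.span F (Set.range v) := by
    have h1 : Algebra.adjoin F (Set.range ρ) = ⊤ := by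
      rw [← adjoin_toSubalgebra_of_isAlgebraic
        fun b _ ↦ Algebra.IsAlgebraic.isAlgebraic b, htop, top_toSubalgebra]
    have h2 : Submodule.span F (Set.range ρ) = ⊤ := by
      have h3 := Algebra.adjoin_eq_span F (Set.range ρ)
      have h4 : (Submonoid.closure (Set.range ρ) : Set E) = Set.range ρ := by
        rw [← MonoidHom.coe_mrange, Submonoid.closure_eq]
      rw [h4, h1] at h3
      rw [← h3]; rfl
    rw [← h2, Submodule.span_le]
    rintro _ ⟨g, rfl⟩
    have h5 : ((g : G ⧸ H).out)⁻¹ * g ∈ H := by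
      rw [← QuotientGroup.eq, QuotientGroup.out_eq']
    obtain ⟨a, ha⟩ := (hH _).1 h5
    have h6 : ρ g = a • v g := by
      rw [Algebra.smul_def, ha, ← map_mul]
      congr 1
      rw [mul_comm, mul_inv_cancel_left]
    rw [h6]
    exact Submodule.smul_mem _ _ (Submodule.subset_span ⟨_, rfl⟩)
  rw [Module.finrank_eq_nat_card_basis (Module.Basis.mk hli hspan), Subgroup.index_eq_card]

theorem index_map_powMonoidHom {G : Type*} [CommGroup G] [Module.Free ℤ (Additive G)]
    [Module.Finite ℤ (Additive G)] (H : Subgroup G) {m : ℕ} (hm : m ≠ 0) :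
    (H.map (powMonoidHom m)).index = m ^ Module.finrank ℤ (Additive G) * H.index := by
  have hinj : Function.Injective (powMonoidHom m : G →* G) :=
    AddSubgroup.nsmulAddMonoidHom_injective_of_isTorsionFree (M := Additive G) hm
  have h1 : (powMonoidHom m : G →* G).range.index = m ^ Module.finrank ℤ (Additive G) := by
    rw [← AddSubgroup.index_range_nsmul (Additive G) m, ← Subgroup.index_toAddSubgroup]
    rfl
  have h2 : (H.map (powMonoidHom m)).relIndex (powMonoidHom m : G →* G).range = H.index := by
    rw [MonoidHom.range_eq_map, Subgroup.relIndex_map_map_of_injective _ _ hinj,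
      Subgroup.relIndex_top_right]
  rw [← Subgroup.relIndex_mul_index (Subgroup.map_le_range _ H), h1, h2, mul_comm]

variable (Γ : Subgroup ℚˣ)

/-- The elements of `Γ` whose positive `k`-th root lies in `ℚ(ζ_k)`. -/
def kummerKernel (k : ℕ) : Subgroup Γ where
  carrier := {g | ∃ x : ℝ, 0 < x ∧ x ^ k = ((g : ℚˣ) : ℚ) ∧ (x : ℂ) ∈ cyclo k}
  mul_mem' := by
    rintro a b ⟨x, hx, hxk, hxm⟩ ⟨y, hy, hyk, hym⟩
    refine ⟨x * y, mul_pos hx hy, ?_, ?_⟩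
    · rw [mul_pow, hxk, hyk]; push_cast; rfl
    · rw [Complex.ofReal_mul]; exact mul_mem hxm hym
  one_mem' := ⟨1, one_pos, by simp, by simp⟩
  inv_mem' := by
    rintro a ⟨x, hx, hxk, hxm⟩
    refine ⟨x⁻¹, inv_pos.2 hx, ?_, ?_⟩
    · rw [inv_pow, hxk]; push_cast; rfl
    · rw [Complex.ofReal_inv]; exact inv_mem hxm

variable {Γ}

theorem cyclo_le_kummerField {k : ℕ} : cyclo k ≤ kummerField Γ k := by
  refine adjoin.mono _ _ _ ?_
  rintro z ⟨n, rfl, -, hz⟩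
  exact Or.inl hz

/-- This form, a compositum of splitting fields, yields normality. The roots of unity come from `g =
1`. -/
theorem kummerField_eq_iSup {k : ℕ} (hk : k ≠ 0) :
    kummerField Γ k = ⨆ g : Γ, adjoin ℚ
      ((Polynomial.X ^ k - Polynomial.C ((g : ℚˣ) : ℚ) : Polynomial ℚ).rootSet ℂ) := by
  have hroot : ∀ (g : ℚ) (z : ℂ),
      z ∈ (Polynomial.X ^ k - Polynomial.C g : Polynomial ℚ).rootSet ℂ ↔ z ^ k = g := by
    intro g z
    rw [Polynomial.mem_rootSet_of_ne (Polynomial.X_pow_sub_C_ne_zero (Nat.pos_of_ne_zero hk) _)]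
    simp [sub_eq_zero]
  apply le_antisymm
  · refine adjoin_le_iff.2 ?_
    rintro z (hz | ⟨g, hg, hz⟩)
    · exact (le_iSup (fun g : Γ => adjoin ℚ
        ((Polynomial.X ^ k - Polynomial.C ((g : ℚˣ) : ℚ) : Polynomial ℚ).rootSet ℂ)) 1)
        (subset_adjoin _ _ ((hroot _ _).2 (by simpa using hz)))
    · exact (le_iSup (fun g : Γ => adjoin ℚ
        ((Polynomial.X ^ k - Polynomial.C ((g : ℚˣ) : ℚ) : Polynomial ℚ).rootSet ℂ)) ⟨g, hg⟩)
        (subset_adjoin _ _ ((hroot _ _).2 hz))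
  · refine iSup_le fun g => adjoin.mono _ _ _ fun z hz => Or.inr ⟨g, g.2, (hroot _ _).1 hz⟩

theorem normal_iSup_adjoin_rootSet {K L ι : Type*} [Field K] [Field L] [Algebra K L]
    [IsAlgClosed L] (p : ι → Polynomial K) : Normal K ↥(⨆ i, adjoin K ((p i).rootSet L)) := by
  have : ∀ i, Normal K (adjoin K ((p i).rootSet L)) := fun i => by
    have := adjoin_rootSet_isSplittingField (K := K) (L := L) (p := p i) (IsAlgClosed.splits _)
    exact Normal.of_isSplittingField (p i)
  exact normal_iSup _ _ _

theorem isGalois_kummerField {k : ℕ} (hk : k ≠ 0) : IsGalois ℚ (kummerField Γ k) := by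
  have : Normal ℚ (kummerField Γ k) := by
    rw [kummerField_eq_iSup hk]
    exact normal_iSup_adjoin_rootSet _
  exact ⟨⟩

/-- The positive real `k`-th root, as a homomorphism on a group of positive rational numbers. -/
noncomputable def posRoot (hpos : ∀ g ∈ Γ, 0 < (g : ℚ)) (k : ℕ) : Γ →* ℝ where
  toFun g := (((g : ℚˣ) : ℚ) : ℝ) ^ ((k : ℝ)⁻¹)
  map_one' := by simp
  map_mul' a b := by
    have ha : (0 : ℝ) ≤ (((a : ℚˣ) : ℚ) : ℝ) := by exact_mod_cast (hpos a a.2).le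
    have hb : (0 : ℝ) ≤ (((b : ℚˣ) : ℚ) : ℝ) := by exact_mod_cast (hpos b b.2).le
    rw [← Real.mul_rpow ha hb]
    push_cast
    rfl

theorem posRoot_pos (hpos : ∀ g ∈ Γ, 0 < (g : ℚ)) (k : ℕ) (g : Γ) : 0 < posRoot hpos k g :=
  Real.rpow_pos_of_pos (by exact_mod_cast hpos g g.2) _

theorem posRoot_pow (hpos : ∀ g ∈ Γ, 0 < (g : ℚ)) {k : ℕ} (hk : k ≠ 0) (g : Γ) :
    posRoot hpos k g ^ k = ((g : ℚˣ) : ℚ) :=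
  Real.rpow_inv_natCast_pow (by exact_mod_cast (hpos g g.2).le) hk

theorem mem_kummerKernel_iff (hpos : ∀ g ∈ Γ, 0 < (g : ℚ)) {k : ℕ} (hk : k ≠ 0) (g : Γ) :
    g ∈ kummerKernel Γ k ↔ (posRoot hpos k g : ℂ) ∈ cyclo k := by
  constructor
  · rintro ⟨x, hx, hxk, hxm⟩
    rw [← posRoot_pow hpos hk] at hxk
    rwa [← (pow_left_inj₀ hx.le (posRoot_pos hpos k g).le hk).1 hxk]
  · exact fun h => ⟨_, posRoot_pos hpos k g, posRoot_pow hpos hk g, h⟩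

theorem finrank_kummerField (hpos : ∀ g ∈ Γ, 0 < (g : ℚ)) {k : ℕ} (hk : k ≠ 0) :
    Module.finrank ℚ (kummerField Γ k) = k.totient * (kummerKernel Γ k).index := by
  have hle : cyclo k ≤ kummerField Γ k := cyclo_le_kummerField
  let E := extendScalars hle
  have : IsGalois ℚ E := isGalois_kummerField hk
  have : IsGalois (cyclo k) E := IsGalois.tower_top_of_isGalois ℚ (cyclo k) E
  have hpow : ∀ g : Γ, ((posRoot hpos k g : ℝ) : ℂ) ^ k = ((g : ℚˣ) : ℚ) := fun g => by
    exact_mod_cast congrArg (fun x : ℝ => (x : ℂ)) (posRoot_pow hpos hk g)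
  have h0 : ∀ g : Γ, ((posRoot hpos k g : ℝ) : ℂ) ≠ 0 := fun g => by
    exact_mod_cast (posRoot_pos hpos k g).ne'
  have hmem : ∀ g : Γ, ((posRoot hpos k g : ℝ) : ℂ) ∈ kummerField Γ k := fun g =>
    subset_adjoin _ _ (Or.inr ⟨g, g.2, hpow g⟩)
  let ρ : Γ →* E :=
    { toFun := fun g => ⟨posRoot hpos k g, hmem g⟩
      map_one' := Subtype.ext (by simp)
      map_mul' := fun a b => Subtype.ext (by simp) }
  have hrange : ∀ x : E, x ∈ Set.range (algebraMap (cyclo k) E) ↔ (x : ℂ) ∈ cyclo k := by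
    intro x
    constructor
    · rintro ⟨y, rfl⟩
      exact y.2
    · exact fun h => ⟨⟨x, h⟩, rfl⟩
  have hρk : ∀ g, ρ g ^ k = algebraMap ℚ E ((g : ℚˣ) : ℚ) := fun g => Subtype.ext (by
    simpa [ρ] using hpow g)
  have hρ0 : ∀ g, ρ g ≠ 0 := fun g h => h0 g (congrArg Subtype.val h)
  have hindex : Module.finrank (cyclo k) E = (kummerKernel Γ k).index := by
    refine finrank_eq_index_of_kummer ρ _ (fun g => ?_) (fun σ g => ?_) ?_
    · rw [hrange, mem_kummerKernel_iff hpos hk]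
      rfl
    · rw [hrange]
      refine mem_cyclo_of_pow_eq_one hk ?_
      have h1 : (σ (ρ g) / ρ g) ^ k = 1 := by
        rw [div_pow, ← map_pow, hρk, IsScalarTower.algebraMap_apply ℚ (cyclo k) E,
          AlgEquiv.commutes, ← IsScalarTower.algebraMap_apply ℚ (cyclo k) E, ← hρk,
          div_self (pow_ne_zero _ (hρ0 g))]
      exact congrArg Subtype.val h1
    · rw [eq_top_iff]
      rintro ⟨x, hx⟩ -
      have hF : ∀ y (hy : y ∈ cyclo k),
          (⟨y, hle hy⟩ : E) ∈ adjoin (cyclo k) (Set.range ρ) := fun y hy =>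
        (adjoin (cyclo k) (Set.range ρ)).algebraMap_mem ⟨y, hy⟩
      have hx' : x ∈ kummerField Γ k := hx
      change (⟨x, hx'⟩ : E) ∈ adjoin (cyclo k) (Set.range ρ)
      clear hx
      unfold kummerField at hx'
      induction hx' using adjoin_induction with
      | mem z hz =>
        rcases hz with hz | ⟨g, hg, hz⟩
        · exact hF z (mem_cyclo_of_pow_eq_one hk hz)
        · have h1 : z / posRoot hpos k ⟨g, hg⟩ ∈ cyclo k := by
            refine mem_cyclo_of_pow_eq_one hk ?_
            rw [div_pow, hz, hpow, div_self]
            exact_mod_cast g.ne_zero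
          have h2 := mul_mem (hF _ h1) (subset_adjoin (cyclo k) _ ⟨⟨g, hg⟩, rfl⟩ :
            ρ ⟨g, hg⟩ ∈ adjoin (cyclo k) (Set.range ρ))
          convert h2 using 1
          exact Subtype.ext (div_mul_cancel₀ z (h0 _)).symm
      | algebraMap q => exact (adjoin (cyclo k) (Set.range ρ)).algebraMap_mem (algebraMap ℚ _ q)
      | add a b _ _ ha hb => exact add_mem ha hb
      | mul a b _ _ ha hb => exact mul_mem ha hb
      | inv a _ ha => exact inv_mem ha
  rw [← hindex, ← finrank_cyclo hk]
  exact (Module.finrank_mul_finrank ℚ (cyclo k) E).symm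

/-! ### A common modulus for the quadratic radicals, and the degree formula -/

theorem eq_one_of_padicValRat_eq_zero {c : ℚ} (hc : 0 < c)
    (h : ∀ p : ℕ, p.Prime → padicValRat p c = 0) : c = 1 := by
  have hnum : c.num.natAbs ≠ 0 := Int.natAbs_ne_zero.2 (Rat.num_pos.2 hc).ne'
  have hv : ∀ p : ℕ, p.Prime → padicValNat p c.num.natAbs = padicValNat p c.den := by
    intro p hp
    have := h p hp
    rw [padicValRat_def, padicValInt] at this
    omega
  have hnd : ∀ p : ℕ, p.Prime → ¬ p ∣ c.num.natAbs ∧ ¬ p ∣ c.den := by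
    intro p hp
    have : Fact p.Prime := ⟨hp⟩
    have h1 := hv p hp
    have h2 := dvd_iff_padicValNat_ne_zero (p := p) hnum
    have h3 := dvd_iff_padicValNat_ne_zero (p := p) c.den_nz
    have h4 : ¬ (p ∣ c.num.natAbs ∧ p ∣ c.den) := fun h =>
      Nat.Prime.not_coprime_iff_dvd.2 ⟨p, hp, h.1, h.2⟩ c.reduced
    rw [h1] at h2
    tauto
  have h1 : c.num.natAbs = 1 := by
    by_contra h1
    obtain ⟨p, hp, hd⟩ := Nat.exists_prime_and_dvd h1
    exact (hnd p hp).1 hd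
  have h2 : c.den = 1 := by
    by_contra h1
    obtain ⟨p, hp, hd⟩ := Nat.exists_prime_and_dvd h1
    exact (hnd p hp).2 hd
  have h3 : c.num = 1 := by have := Rat.num_pos.2 hc; omega
  rw [← Rat.num_div_den c, h2, h3]; simp

/-- The positive rational numbers having a nontrivial power in `Γ`. -/
def saturation (Γ : Subgroup ℚˣ) : Subgroup ℚˣ where
  carrier := {c | 0 < (c : ℚ) ∧ ∃ j ≠ 0, c ^ j ∈ Γ}
  mul_mem' := by
    rintro a b ⟨ha, i, hi, hai⟩ ⟨hb, j, hj, hbj⟩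
    refine ⟨by rw [Units.val_mul]; positivity, i * j, mul_ne_zero hi hj, ?_⟩
    rw [mul_pow, pow_mul, pow_mul' b]
    exact mul_mem (pow_mem hai _) (pow_mem hbj _)
  one_mem' := ⟨by simp, 1, one_ne_zero, by simp⟩
  inv_mem' := by
    rintro a ⟨ha, i, hi, hai⟩
    refine ⟨by rw [Units.val_inv_eq_inv_val]; positivity, i, hi, ?_⟩
    rw [inv_pow]
    exact inv_mem hai

/-- The `p`-adic valuation as a homomorphism on nonzero rational numbers. -/
def valHom (p : ℕ) [Fact p.Prime] : Additive ℚˣ →+ ℤ where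
  toFun c := padicValRat p (c.toMul : ℚ)
  map_zero' := by simp
  map_add' a b := by
    rw [toMul_add, Units.val_mul, padicValRat.mul (Units.ne_zero _) (Units.ne_zero _)]

/-- Valuations at primes not occurring in the generators vanish on `Γ`, hence on its saturation, as
`j v = 0` forces `v = 0`. The remaining valuations determine a positive rational, so the saturation
embeds in some `ℤ^P`. -/
theorem fg_saturation (hfg : Γ.FG) : (saturation Γ).FG := by
  obtain ⟨s, hs⟩ := hfg
  let P : Finset ℕ := s.biUnion fun g =>
    ((g : ℚ).num.natAbs.primeFactors ∪ (g : ℚ).den.primeFactors)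
  have hprime : ∀ p : P, Fact (p : ℕ).Prime := by
    rintro ⟨p, hp⟩
    simp only [P, Finset.mem_biUnion, Finset.mem_union] at hp
    obtain ⟨g, -, h | h⟩ := hp <;> exact ⟨Nat.prime_of_mem_primeFactors h⟩
  have hΓ : ∀ p : ℕ, p.Prime → p ∉ P → ∀ g ∈ Γ, padicValRat p (g : ℚ) = 0 := by
    intro p hp hpP g hg
    have : Fact p.Prime := ⟨hp⟩
    rw [← hs] at hg
    induction hg using Subgroup.closure_induction with
    | mem g hg =>
      simp only [P, Finset.mem_biUnion, Finset.mem_union, not_exists, not_and, not_or] at hpP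
      obtain ⟨h1, h2⟩ := hpP g hg
      rw [padicValRat_def, padicValInt, padicValNat.eq_zero_of_not_dvd,
        padicValNat.eq_zero_of_not_dvd]
      · simp
      · exact fun h => h2 (Nat.mem_primeFactors.2 ⟨hp, h, (g : ℚ).den_nz⟩)
      · exact fun h => h1 (Nat.mem_primeFactors.2 ⟨hp, h,
          Int.natAbs_ne_zero.2 (Rat.num_ne_zero.2 g.ne_zero)⟩)
    | one => simp
    | mul a b _ _ ha hb => rw [Units.val_mul, padicValRat.mul a.ne_zero b.ne_zero, ha, hb, add_zero]
    | inv a _ ha => rw [Units.val_inv_eq_inv_val, padicValRat.inv, ha, neg_zero]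
  let φ : Additive (saturation Γ) →+ (P → ℤ) :=
    AddMonoidHom.mk' (fun c p => valHom p (Additive.ofMul (c.toMul : ℚˣ))) (by
      intro a b
      funext p
      exact (valHom p).map_add (Additive.ofMul (a.toMul : ℚˣ)) (Additive.ofMul (b.toMul : ℚˣ)))
  have hφ : Function.Injective φ := by
    rw [injective_iff_map_eq_zero]
    intro c hc
    obtain ⟨hpos, j, hj, hcj⟩ := c.toMul.2
    have h1 : ((c.toMul : ℚˣ) : ℚ) = 1 := by
      refine eq_one_of_padicValRat_eq_zero hpos fun p hp => ?_
      by_cases hpP : p ∈ P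
      · exact congrFun hc ⟨p, hpP⟩
      · have : Fact p.Prime := ⟨hp⟩
        have := hΓ p hp hpP _ hcj
        rw [Units.val_pow_eq_pow_val, padicValRat.pow] at this
        rcases mul_eq_zero.1 this with h | h
        · exact absurd (by exact_mod_cast h) hj
        · exact h
    exact Additive.toMul.injective (Subtype.ext (Units.ext h1))
  have : Module.Finite ℤ (Additive (saturation Γ)) :=
    Module.Finite.of_injective φ.toIntLinearMap hφ
  rw [← Group.fg_iff_subgroup_fg, GroupFG.iff_add_fg]
  exact Module.Finite.iff_addGroup_fg.1 this

/-- A modulus over which all quadratic radicals of `Γ` are defined. -/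
theorem exists_radical_modulus (hfg : Γ.FG) : ∃ N ≠ 0, ∀ x : ℝ, 0 < x → (∃ d : ℚ, x ^ 2 = d) →
    (∃ j ≠ 0, ∃ g ∈ Γ, x ^ j = (g : ℚ)) →
      (x : ℂ) ∈ cyclo N ∧ ∃ g ∈ Γ, x ^ N = (g : ℚ) := by
  let Q : ℕ → ℚˣ → Prop := fun N c =>
    ((√((c : ℚ) : ℝ) : ℝ) : ℂ) ∈ cyclo N ∧ ∃ g ∈ Γ, √((c : ℚ) : ℝ) ^ N = (g : ℚ)
  have hmono : ∀ N M c, M ≠ 0 → N ∣ M → Q N c → Q M c := by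
    rintro N M c hM hNM ⟨h1, g, hg, h2⟩
    refine ⟨cyclo_mono hM hNM h1, ?_⟩
    obtain ⟨e, rfl⟩ := hNM
    exact ⟨g ^ e, pow_mem hg e, by rw [pow_mul, h2]; push_cast; rfl⟩
  have hex : ∀ c ∈ saturation Γ, ∃ N ≠ 0, Q N c := by
    rintro c ⟨hc, j, hj, hcj⟩
    obtain ⟨n, hn, h⟩ := exists_sqrt_rat_mem_cyclo hc
    have h0 : 2 * (j * n) ≠ 0 := by positivity
    -- `√c ^ (2jn) = (c ^ j) ^ n` lies in `Γ`, and `n` divides the exponent.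
    refine ⟨2 * (j * n), h0, cyclo_mono h0 ⟨2 * j, by ring⟩ h, (c ^ j) ^ n, pow_mem hcj n, ?_⟩
    rw [pow_mul, Real.sq_sqrt (by exact_mod_cast hc.le), pow_mul]
    push_cast
    rfl
  obtain ⟨s, hs⟩ := fg_saturation hfg
  have hs' : ∀ c ∈ s, c ∈ saturation Γ := fun c hc => hs ▸ Subgroup.subset_closure hc
  choose! n hn0 hn using fun c hc => hex c (hs' c hc)
  have hN : ∏ c ∈ s, n c ≠ 0 := Finset.prod_ne_zero_iff.2 hn0
  have hall : ∀ c ∈ saturation Γ, Q (∏ c ∈ s, n c) c := by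
    intro c hc
    rw [← hs] at hc
    induction hc using Subgroup.closure_induction with
    | mem c hc => exact hmono _ _ c hN (Finset.dvd_prod_of_mem n hc) (hn c hc)
    | one => exact ⟨by simp, 1, one_mem _, by simp⟩
    | mul a b ha' hb' ha hb =>
      have hpos : (0 : ℝ) ≤ ((a : ℚ) : ℝ) := by exact_mod_cast (hs ▸ ha' : a ∈ saturation Γ).1.le
      obtain ⟨h1, g, hg, h2⟩ := ha
      obtain ⟨h3, g', hg', h4⟩ := hb
      have hm : √(((a * b : ℚˣ) : ℚ) : ℝ) = √((a : ℚ) : ℝ) * √((b : ℚ) : ℝ) := by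
        rw [← Real.sqrt_mul hpos]; push_cast; rfl
      refine ⟨?_, g * g', mul_mem hg hg', ?_⟩
      · rw [hm, Complex.ofReal_mul]; exact mul_mem h1 h3
      · rw [hm, mul_pow, h2, h4]; push_cast; rfl
    | inv a _ ha =>
      obtain ⟨h1, g, hg, h2⟩ := ha
      have hm : √(((a⁻¹ : ℚˣ) : ℚ) : ℝ) = (√((a : ℚ) : ℝ))⁻¹ := by
        rw [← Real.sqrt_inv]; push_cast; rfl
      refine ⟨?_, g⁻¹, inv_mem hg, ?_⟩
      · rw [hm, Complex.ofReal_inv]; exact inv_mem h1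
      · rw [hm, inv_pow, h2]; push_cast; rfl
  refine ⟨_, hN, ?_⟩
  rintro x hx ⟨d, hd⟩ ⟨j, hj, g, hg, hxj⟩
  have hd0 : 0 < d := by
    have : (0 : ℝ) < d := hd ▸ pow_pos hx 2
    exact_mod_cast this
  have hmem : Units.mk0 d hd0.ne' ∈ saturation Γ := by
    refine ⟨hd0, j, hj, ?_⟩
    have : Units.mk0 d hd0.ne' ^ j = g ^ 2 := by
      apply Units.ext
      have : ((d : ℝ)) ^ j = ((g : ℚ) : ℝ) ^ 2 := by rw [← hd, ← hxj, pow_right_comm]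
      rw [Units.val_pow_eq_pow_val, Units.val_pow_eq_pow_val, Units.val_mk0]
      exact Rat.cast_injective (α := ℝ) (by push_cast; exact this)
    rw [this]
    exact pow_mem hg 2
  have hsq : √(((Units.mk0 d hd0.ne' : ℚˣ) : ℚ) : ℝ) = x := by
    rw [Units.val_mk0, ← hd, Real.sqrt_sq hx.le]
  have := hall _ hmem
  simp only [Q, hsq] at this
  exact this

/-- A root `x` in `ℚ(ζ_k)` is quadratic, so it lies in `ℚ(ζ_N)` and `x ^ N ∈ Γ`. Intersecting, `x ∈
ℚ(ζ_d)` with `d = gcd(k, N)`; by Bézout `δ = x ^ d` lies in `Γ`, and `g = δ ^ (k/d)`. -/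
theorem kummerKernel_eq_map {N k : ℕ} (hk : k ≠ 0) (hN : N ≠ 0)
    (hΓN : ∀ x : ℝ, 0 < x → (∃ d : ℚ, x ^ 2 = d) → (∃ j ≠ 0, ∃ g ∈ Γ, x ^ j = (g : ℚ)) →
      (x : ℂ) ∈ cyclo N ∧ ∃ g ∈ Γ, x ^ N = (g : ℚ)) :
    kummerKernel Γ k = (kummerKernel Γ (k.gcd N)).map (powMonoidHom (k / k.gcd N)) := by
  have hd0 : k.gcd N ≠ 0 := Nat.gcd_ne_zero_left hk
  have hdm : k.gcd N * (k / k.gcd N) = k := Nat.mul_div_cancel' (Nat.gcd_dvd_left k N)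
  ext g
  constructor
  · rintro ⟨x, hx, hxk, hxm⟩
    obtain ⟨h1, g', hg', h2⟩ := hΓN x hx (sq_rat_of_mem_cyclo hk hxk hxm) ⟨k, hk, g, g.2, hxk⟩
    have h3 : (x : ℂ) ∈ cyclo (k.gcd N) := cyclo_inf_cyclo_le hk hN (mem_inf.2 ⟨hxm, h1⟩)
    let δ : Γ := g ^ k.gcdA N * (⟨g', hg'⟩ : Γ) ^ k.gcdB N
    have hδ : x ^ k.gcd N = ((δ : ℚˣ) : ℚ) := by
      rw [← zpow_natCast, Nat.gcd_eq_gcd_ab, zpow_add₀ hx.ne', zpow_mul, zpow_mul, zpow_natCast,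
        zpow_natCast, hxk, h2]
      simp only [δ]
      push_cast
      rfl
    refine ⟨δ, ⟨x, hx, hδ, h3⟩, ?_⟩
    apply Subtype.ext
    apply Units.ext
    have : (((δ : ℚˣ) : ℚ) : ℝ) ^ (k / k.gcd N) = ((g : ℚˣ) : ℚ) := by
      rw [← hδ, ← pow_mul, hdm, hxk]
    simp only [powMonoidHom_apply]
    push_cast
    exact_mod_cast this
  · rintro ⟨δ, ⟨x, hx, hxd, hxm⟩, rfl⟩
    refine ⟨x, hx, ?_, cyclo_mono hk (Nat.gcd_dvd_left k N) hxm⟩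
    conv_lhs => rw [← hdm, pow_mul, hxd]
    simp only [powMonoidHom_apply]
    push_cast
    rfl

theorem finite_additive (hfg : Γ.FG) : Module.Finite ℤ (Additive Γ) := by
  rw [Module.Finite.iff_addGroup_fg, ← GroupFG.iff_add_fg, Group.fg_iff_subgroup_fg]
  exact hfg

theorem free_additive (hfg : Γ.FG) (hpos : ∀ g ∈ Γ, 0 < (g : ℚ)) :
    Module.Free ℤ (Additive Γ) := by
  have := finite_additive hfg
  have : IsMulTorsionFree Γ := ⟨fun n hn a b h => by
    apply Subtype.ext
    apply Units.ext
    refine (pow_left_inj₀ (hpos a a.2).le (hpos b b.2).le hn).1 ?_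
    have := congrArg (fun z : Γ => ((z : ℚˣ) : ℚ)) h
    simpa using this⟩
  infer_instance

/-- The degrees `[ℚ(ζ_k, Γ^{1/k}) : ℚ]` are determined by finitely many of the indices of the
Kummer kernels. -/
theorem exists_finrank_kummerField_eq (hfg : Γ.FG) (hpos : ∀ g ∈ Γ, 0 < (g : ℚ)) :
    ∃ N ≠ 0, ∃ I : ℕ → ℕ, (∀ d, d ≠ 0 → I d ≠ 0) ∧ ∀ k ≠ 0,
      Module.finrank ℚ (kummerField Γ k) =
        k.totient * ((k / k.gcd N) ^ Module.finrank ℤ (Additive Γ) * I (k.gcd N)) := by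
  have := finite_additive hfg
  have := free_additive hfg hpos
  obtain ⟨N, hN, hΓN⟩ := exists_radical_modulus hfg
  refine ⟨N, hN, fun d => (kummerKernel Γ d).index, fun d hd => ?_, fun k hk => ?_⟩
  -- The `d`-th powers lie in the kernel and have finite index `d ^ rank`.
  · have hle : (⊤ : Subgroup Γ).map (powMonoidHom d) ≤ kummerKernel Γ d := by
      rintro _ ⟨g, -, rfl⟩
      refine ⟨((g : ℚˣ) : ℚ), by exact_mod_cast hpos g g.2, by simp, by simp⟩
    refine ne_zero_of_dvd_ne_zero ?_ (Subgroup.index_dvd_of_le hle)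
    rw [index_map_powMonoidHom _ hd, Subgroup.index_top, mul_one]
    exact pow_ne_zero _ hd
  · have hm : k / k.gcd N ≠ 0 :=
      (Nat.div_pos (Nat.gcd_le_left N (Nat.pos_of_ne_zero hk))
        (Nat.gcd_pos_of_pos_left N (Nat.pos_of_ne_zero hk))).ne'
    rw [finrank_kummerField hpos hk, kummerKernel_eq_map hk hN hΓN, index_map_powMonoidHom _ hm]

/-! ### The multiplicative main term and its Euler product -/

/-- The multiplicative function `rad(k) (-1)^{ω(k)} / k^{r+2}`. -/
noncomputable def radTerm (r k : ℕ) : ℝ := (∏ l ∈ k.primeFactors, (-(l : ℝ))) / (k : ℝ) ^ (r + 2)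

theorem radTerm_zero (r : ℕ) : radTerm r 0 = 0 := by simp [radTerm]

theorem radTerm_one (r : ℕ) : radTerm r 1 = 1 := by simp [radTerm]

theorem radTerm_mul_of_coprime (r : ℕ) {m n : ℕ} (h : m.Coprime n) :
    radTerm r (m * n) = radTerm r m * radTerm r n := by
  rw [radTerm, h.primeFactors_mul, Finset.prod_union h.disjoint_primeFactors, radTerm, radTerm]
  push_cast
  rw [mul_pow, mul_div_mul_comm]

theorem radTerm_prime_mul_of_dvd (r : ℕ) {p j : ℕ} (hp : p.Prime) (h : p ∣ j) :
    radTerm r (p * j) = radTerm r j / (p : ℝ) ^ (r + 2) := by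
  rcases eq_or_ne j 0 with rfl | hj
  · simp [radTerm_zero]
  · have : (p * j).primeFactors = j.primeFactors := by
      rw [Nat.primeFactors_mul hp.ne_zero hj, hp.primeFactors, Finset.union_eq_right,
        Finset.singleton_subset_iff]
      exact Nat.mem_primeFactors.2 ⟨hp, h, hj⟩
    rw [radTerm, this, radTerm]
    push_cast
    rw [mul_pow, div_div, mul_comm]

theorem radTerm_prime (r : ℕ) {p : ℕ} (hp : p.Prime) :
    radTerm r p = -(p : ℝ) / (p : ℝ) ^ (r + 2) := by
  simp [radTerm, hp.primeFactors]

theorem radTerm_prime_pow (r : ℕ) {p : ℕ} (hp : p.Prime) (a : ℕ) :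
    radTerm r (p ^ (a + 1)) = -(p : ℝ) * ((p : ℝ) ^ (r + 2))⁻¹ ^ (a + 1) := by
  rw [radTerm, Nat.primeFactors_prime_pow (Nat.succ_ne_zero a) hp, Finset.prod_singleton]
  push_cast
  rw [← pow_mul, mul_comm (a + 1), pow_mul, inv_pow, div_eq_mul_inv]

theorem abs_radTerm_le {r : ℕ} (hr : 1 ≤ r) (k : ℕ) : |radTerm r k| ≤ 1 / (k : ℝ) ^ 2 := by
  rcases eq_or_ne k 0 with rfl | hk
  · simp [radTerm_zero]
  have hk1 : (1 : ℝ) ≤ k := by exact_mod_cast Nat.one_le_iff_ne_zero.2 hk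
  have h1 : |∏ l ∈ k.primeFactors, (-(l : ℝ))| ≤ k := by
    rw [Finset.abs_prod]
    simp only [abs_neg, Nat.abs_cast]
    have := Nat.le_of_dvd (Nat.pos_of_ne_zero hk) (Nat.prod_primeFactors_dvd k)
    rw [← Nat.cast_prod]
    exact_mod_cast this
  rw [radTerm, abs_div, abs_of_pos (by positivity : (0 : ℝ) < (k : ℝ) ^ (r + 2)),
    div_le_div_iff₀ (by positivity) (by positivity), one_mul]
  calc |∏ l ∈ k.primeFactors, (-(l : ℝ))| * (k : ℝ) ^ 2 ≤ k * (k : ℝ) ^ 2 := by gcongr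
    _ = (k : ℝ) ^ 3 := by ring
    _ ≤ (k : ℝ) ^ (r + 2) := pow_le_pow_right₀ hk1 (by omega)

theorem summable_norm_radTerm {r : ℕ} (hr : 1 ≤ r) : Summable fun k => ‖radTerm r k‖ :=
  Summable.of_nonneg_of_le (fun _ => norm_nonneg _) (abs_radTerm_le hr)
    (Real.summable_one_div_nat_pow.2 one_lt_two)

theorem tsum_radTerm_prime_pow (r : ℕ) (p : Nat.Primes) :
    ∑' e, radTerm r ((p : ℕ) ^ e) = eulerFactor r p := by
  have hp := p.2
  have hp1 : (1 : ℝ) < (p : ℕ) := by exact_mod_cast hp.one_lt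
  have hpr : (1 : ℝ) < ((p : ℕ) : ℝ) ^ (r + 2) := one_lt_pow₀ hp1 (by omega)
  have hg := hasSum_geometric_of_lt_one (inv_nonneg.2 (zero_le_one.trans hpr.le))
    (inv_lt_one_of_one_lt₀ hpr)
  have h1 : HasSum (fun a => radTerm r ((p : ℕ) ^ (a + 1)))
      (-((p : ℕ) : ℝ) * (((((p : ℕ) : ℝ) ^ (r + 2)))⁻¹ *
        (1 - (((p : ℕ) : ℝ) ^ (r + 2))⁻¹)⁻¹)) := by
    simp only [radTerm_prime_pow r hp, pow_succ' (((p : ℕ) : ℝ) ^ (r + 2))⁻¹]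
    exact (hg.mul_left _).mul_left _
  have h2 := (hasSum_nat_add_iff (f := fun a => radTerm r ((p : ℕ) ^ a)) 1).1 h1
  rw [Finset.sum_range_one, pow_zero, radTerm_one] at h2
  rw [h2.tsum_eq, eulerFactor]
  have : ((p : ℕ) : ℝ) ^ (r + 2) - 1 ≠ 0 := by linarith
  have h0 : ((p : ℕ) : ℝ) ^ (r + 2) ≠ 0 := by linarith
  have h3 : 1 - (((p : ℕ) : ℝ) ^ (r + 2))⁻¹ = (((p : ℕ) : ℝ) ^ (r + 2) - 1) /
    ((p : ℕ) : ℝ) ^ (r + 2) := by rw [sub_div, div_self h0, one_div]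
  rw [h3]
  field_simp
  ring

theorem hasProd_eulerFactor {r : ℕ} (hr : 1 ≤ r) :
    HasProd (eulerFactor r) (∑' k, radTerm r k) := by
  have := EulerProduct.eulerProduct_hasProd (radTerm_one r)
    (fun {m n} h => radTerm_mul_of_coprime r (m := m) (n := n) h) (summable_norm_radTerm hr)
    (radTerm_zero r)
  simpa only [tsum_radTerm_prime_pow] using this

/-! ### Sums over multiples and rationality -/

/-- The sum of `radTerm` over the multiples of `e`. -/
noncomputable def multipleSum (r e : ℕ) : ℝ := ∑' k, {k | e ∣ k}.indicator (radTerm r) k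

theorem summable_indicator_radTerm {r : ℕ} (hr : 1 ≤ r) (s : Set ℕ) :
    Summable (s.indicator (radTerm r)) :=
  (summable_norm_radTerm hr).of_norm.indicator s

/-- Write the multiples of `p e` as `p j` with `e ∣ j`. If `p ∣ j` the radical is unchanged;
otherwise `p` contributes a new factor `-p`. -/
theorem multipleSum_prime_mul {r : ℕ} (hr : 1 ≤ r) {p : ℕ} (hp : p.Prime) (e : ℕ) :
    multipleSum r (p * e) = (multipleSum r (p.lcm e) -
      p * (multipleSum r e - multipleSum r (p.lcm e))) / (p : ℝ) ^ (r + 2) := by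
  have hinj : Function.Injective fun j => p * j := fun a b h =>
    Nat.eq_of_mul_eq_mul_left hp.pos h
  have h1 : multipleSum r (p * e) =
      ∑' j, {k | p * e ∣ k}.indicator (radTerm r) (p * j) := by
    refine (hinj.tsum_eq ?_).symm
    intro k hk
    have : k ∈ {k | p * e ∣ k} := Set.mem_of_indicator_ne_zero hk
    rw [Set.mem_ofPred_eq] at this
    obtain ⟨c, rfl⟩ := this
    exact ⟨e * c, (mul_assoc _ _ _).symm⟩
  have h2 : ∀ j, {k | p * e ∣ k}.indicator (radTerm r) (p * j) =
      ({k | p.lcm e ∣ k}.indicator (radTerm r) j - p * ({k | e ∣ k}.indicator (radTerm r) j -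
        {k | p.lcm e ∣ k}.indicator (radTerm r) j)) / (p : ℝ) ^ (r + 2) := by
    intro j
    simp only [Set.indicator_apply, Set.mem_ofPred_eq, Nat.lcm_dvd_iff,
      Nat.mul_dvd_mul_iff_left hp.pos]
    by_cases he : e ∣ j
    · by_cases hpj : p ∣ j
      · simp [he, hpj, radTerm_prime_mul_of_dvd r hp hpj]
      · rw [radTerm_mul_of_coprime r ((hp.coprime_iff_not_dvd).2 hpj), radTerm_prime r hp]
        simp [he, hpj]
        ring
    · simp [he]
  have s1 := summable_indicator_radTerm hr {k | p.lcm e ∣ k}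
  have s2 := summable_indicator_radTerm hr {k | e ∣ k}
  rw [h1, tsum_congr h2, tsum_div_const, (s1.tsum_sub ((s2.sub s1).mul_left _)), tsum_mul_left,
    s2.tsum_sub s1]
  rfl

theorem multipleSum_eq_rat_mul {r : ℕ} (hr : 1 ≤ r) {e : ℕ} (he : e ≠ 0) :
    ∃ q : ℚ, multipleSum r e = q * ∑' k, radTerm r k := by
  induction e using induction_on_primes with
  | zero => exact absurd rfl he
  | one => exact ⟨1, by simp [multipleSum]⟩
  | prime_mul p a hp ih =>
    obtain ⟨q, hq⟩ := ih (right_ne_zero_of_mul he)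
    have hp2 : (2 : ℝ) ≤ p := by exact_mod_cast hp.two_le
    have h := multipleSum_prime_mul hr hp a
    by_cases hpa : p ∣ a
    · refine ⟨q / (p : ℚ) ^ (r + 2), ?_⟩
      rw [h, Nat.lcm_eq_right hpa, hq]
      push_cast
      ring
    -- Here the lcm is `p * a`, so the recursion is a linear equation for the unknown sum, with
    -- coefficient `p^{r+2} - 1 - p > 0`.
    · rw [((hp.coprime_iff_not_dvd).2 hpa).lcm_eq_mul, hq] at h
      have hp3 : (p : ℝ) ^ 3 ≤ (p : ℝ) ^ (r + 2) := pow_le_pow_right₀ (by linarith) (by omega)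
      have hne : (p : ℝ) ^ (r + 2) - 1 - p ≠ 0 := by
        nlinarith [mul_nonneg (sub_nonneg.2 hp2) (sub_nonneg.2 hp2)]
      refine ⟨-(p : ℚ) * q / ((p : ℚ) ^ (r + 2) - 1 - p), ?_⟩
      push_cast
      rw [div_mul_eq_mul_div, eq_div_iff hne]
      rw [eq_div_iff (by positivity)] at h
      linear_combination h

theorem jordanTotient_one (k : ℕ) : jordanTotient 1 k = k.totient := by
  have := congrArg (fun q : ℚ => (q : ℝ)) (Nat.totient_eq_mul_prod_factors k)
  push_cast at this
  rw [this, jordanTotient]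
  simp

theorem rad_mul_neg_one_pow (k : ℕ) :
    (rad k : ℝ) ^ 1 * (-1) ^ (ArithmeticFunction.cardDistinctFactors k) =
      ∏ l ∈ k.primeFactors, (-(l : ℝ)) := by
  rw [Finset.prod_neg, rad, ArithmeticFunction.cardDistinctFactors_apply, pow_one, mul_comm]
  push_cast
  rfl

theorem seriesTerm_eq {Γ : Subgroup ℚˣ} {N r : ℕ} {I : ℕ → ℕ}
    (hI : ∀ k ≠ 0, Module.finrank ℚ (kummerField Γ k) =
      k.totient * ((k / k.gcd N) ^ r * I (k.gcd N))) (k : ℕ+) :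
    seriesTerm Γ 1 k = radTerm r k * (((k : ℕ).gcd N : ℝ) ^ r / I ((k : ℕ).gcd N)) := by
  have hk : (k : ℕ) ≠ 0 := k.ne_zero
  have hk0 : ((k : ℕ) : ℝ) ≠ 0 := by exact_mod_cast hk
  have hφ : (((k : ℕ).totient : ℕ) : ℝ) ≠ 0 := by
    exact_mod_cast (Nat.totient_pos.2 k.pos).ne'
  have hg0 : (((k : ℕ).gcd N : ℕ) : ℝ) ≠ 0 := by exact_mod_cast Nat.gcd_ne_zero_left hk
  have h3 : (((k : ℕ) / (k : ℕ).gcd N : ℕ) : ℝ) = (k : ℕ) / ((k : ℕ).gcd N : ℕ) :=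
    Nat.cast_div (Nat.gcd_dvd_left _ _) hg0
  rw [seriesTerm, mul_assoc, jordanTotient_one, rad_mul_neg_one_pow, hI k hk, radTerm]
  push_cast
  rw [h3, div_pow]
  -- If `I` vanishes here, both sides are divisions by zero, hence 0.
  rcases eq_or_ne ((I ((k : ℕ).gcd N) : ℕ) : ℝ) 0 with h0 | h0
  · simp [h0]
  field_simp
  ring

theorem exists_sum_divisors_eq (F : ℕ → ℚ) :
    ∃ c : ℕ → ℚ, ∀ n > 0, ∑ i ∈ n.divisors, c i = F n :=
  ⟨_, ArithmeticFunction.sum_eq_iff_sum_mul_moebius_eq.2 fun _ _ => rfl⟩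

/-- With `F(n) = ∑_{e ∣ n} c(e)`, the value at `gcd(k, N)` is the sum of `c(e)` over the divisors
`e` of `N` that divide `k`; exchange the sums. -/
theorem tsum_radTerm_mul_gcd {r : ℕ} (hr : 1 ≤ r) {N : ℕ} (hN : N ≠ 0) (F : ℕ → ℚ) :
    Summable (fun k : ℕ => radTerm r k * F (k.gcd N)) ∧
    ∃ q : ℚ, ∑' k : ℕ, radTerm r k * F (k.gcd N) = q * ∑' k, radTerm r k := by
  obtain ⟨c, hc⟩ := exists_sum_divisors_eq F
  have h1 : ∀ k : ℕ, radTerm r k * F (k.gcd N) =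
      ∑ e ∈ N.divisors, c e * {k | e ∣ k}.indicator (radTerm r) k := by
    intro k
    rw [← hc _ (Nat.gcd_pos_of_pos_right k (Nat.pos_of_ne_zero hN))]
    push_cast
    rw [Finset.mul_sum]
    simp only [Set.indicator_apply, Set.mem_ofPred_eq, mul_ite, mul_zero]
    rw [← Finset.sum_filter]
    refine Finset.sum_congr ?_ fun _ _ => mul_comm _ _
    ext e
    simp only [Nat.mem_divisors, Finset.mem_filter, Nat.dvd_gcd_iff]
    have := Nat.gcd_ne_zero_right (m := k) hN
    tauto
  have hs : ∀ e, Summable fun k => (c e : ℝ) * {k | e ∣ k}.indicator (radTerm r) k := fun e =>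
    (summable_indicator_radTerm hr _).mul_left _
  choose! q hq using fun e (he : e ≠ 0) => multipleSum_eq_rat_mul hr he
  refine ⟨?_, ∑ e ∈ N.divisors, c e * q e, ?_⟩
  · simp only [h1]
    exact summable_sum fun e _ => hs e
  · rw [tsum_congr h1, Summable.tsum_finsetSum fun e _ => hs e]
    push_cast
    rw [Finset.sum_mul]
    refine Finset.sum_congr rfl fun e he => ?_
    rw [tsum_mul_left, mul_assoc, ← hq e (ne_zero_of_dvd_ne_zero hN (Nat.dvd_of_mem_divisors he))]
    rfl

/-! ### Nonvanishing: averaging over a Galois group -/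

/-- The multiplicative function `φ(k) rad(k) (-1)^{ω(k)} / k²`, the Möbius inverse of `1 / n`. -/
noncomputable def invWeight (k : ℕ) : ℝ :=
  k.totient * (∏ l ∈ k.primeFactors, (-(l : ℝ))) / (k : ℝ) ^ 2

theorem invWeight_mul_of_coprime {m n : ℕ} (h : m.Coprime n) :
    invWeight (m * n) = invWeight m * invWeight n := by
  rw [invWeight, h.primeFactors_mul, Finset.prod_union h.disjoint_primeFactors,
    Nat.totient_mul h, invWeight, invWeight]
  push_cast
  rw [mul_pow, ← mul_div_mul_comm]
  ring

theorem invWeight_prime_pow {p : ℕ} (hp : p.Prime) (a : ℕ) :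
    invWeight (p ^ (a + 1)) = 1 / (p : ℝ) ^ (a + 1) - 1 / (p : ℝ) ^ a := by
  have h0 : (p : ℝ) ≠ 0 := by exact_mod_cast hp.ne_zero
  rw [invWeight, Nat.primeFactors_prime_pow (Nat.succ_ne_zero a) hp, Finset.prod_singleton,
    Nat.totient_prime_pow_succ hp]
  push_cast [Nat.cast_sub hp.one_le]
  field_simp
  ring

/-- On prime powers the sum telescopes; multiplicativity does the rest. -/
theorem sum_divisors_invWeight {n : ℕ} (hn : n ≠ 0) :
    ∑ k ∈ n.divisors, invWeight k = 1 / (n : ℝ) := by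
  induction n using Nat.recOnPosPrimePosCoprime with
  | zero => exact absurd rfl hn
  | one => simp [invWeight]
  | prime_pow p a hp ha =>
    rw [Nat.sum_divisors_prime_pow hp]
    clear ha hn
    induction a with
    | zero => simp [invWeight]
    | succ a ih =>
      rw [Finset.sum_range_succ, ih, invWeight_prime_pow hp]
      push_cast
      ring
  | coprime a b ha hb hab iha ihb =>
    let f : ArithmeticFunction ℝ := ⟨invWeight, by simp [invWeight]⟩
    have hf : f.IsMultiplicative :=
      ⟨by simp [f, invWeight], fun {m n} h => invWeight_mul_of_coprime h⟩
    have hfζ := hf.mul ArithmeticFunction.isMultiplicative_zeta.natCast (R := ℝ)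
    have h := hfζ.2 hab
    simp only [ArithmeticFunction.coe_mul_zeta_apply] at h
    change ∑ k ∈ (a * b).divisors, invWeight k =
      (∑ k ∈ a.divisors, invWeight k) * ∑ k ∈ b.divisors, invWeight k at h
    rw [h, iha (by omega), ihb (by omega)]
    push_cast
    rw [one_div_mul_one_div]

theorem kummerField_mono {Γ : Subgroup ℚˣ} {a b : ℕ} (hb : b ≠ 0) (h : a ∣ b) :
    kummerField Γ a ≤ kummerField Γ b := by
  obtain ⟨c, rfl⟩ := h
  have hroot : ∀ z : ℂ, z ^ a = 1 → z ∈ kummerField Γ (a * c) := fun z hz =>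
    subset_adjoin _ _ (Or.inl (by rw [Set.mem_ofPred_eq, pow_mul, hz, one_pow]))
  refine adjoin_le_iff.2 ?_
  rintro z (hz | ⟨g, hg, hz⟩)
  · exact hroot z hz
  · obtain ⟨w, hw⟩ := IsAlgClosed.exists_pow_nat_eq ((g : ℚ) : ℂ) (Nat.pos_of_ne_zero hb)
    have hwm : w ∈ kummerField Γ (a * c) := subset_adjoin _ _ (Or.inr ⟨g, hg, hw⟩)
    have hw0 : w ≠ 0 := by
      rintro rfl
      rw [zero_pow hb] at hw
      exact g.ne_zero (by exact_mod_cast hw.symm)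
    have h1 : z / w ^ c ∈ kummerField Γ (a * c) := by
      refine hroot _ ?_
      rw [div_pow, hz, ← pow_mul, mul_comm c a, hw, div_self]
      exact_mod_cast g.ne_zero
    have := mul_mem h1 (pow_mem hwm c)
    rwa [div_mul_cancel₀ _ (pow_ne_zero _ hw0)] at this

/-- With `lcm = a c = b d`, `c` and `d` are coprime, so `z` is a product of powers of `z ^ c` and `z
^ d`, which are roots of order `a` and `b`. -/
theorem kummerField_lcm_le {Γ : Subgroup ℚˣ} {a b : ℕ} (ha : a ≠ 0) (hb : b ≠ 0) :
    kummerField Γ (a.lcm b) ≤ kummerField Γ a ⊔ kummerField Γ b := by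
  obtain ⟨c, hc⟩ := Nat.dvd_lcm_left a b
  obtain ⟨d, hd⟩ := Nat.dvd_lcm_right a b
  have hl := Nat.lcm_ne_zero ha hb
  have hcd : c.Coprime d := by
    obtain ⟨a', b', hco, ha', hb'⟩ := Nat.exists_coprime a b
    have hg := Nat.gcd_pos_of_pos_left b (Nat.pos_of_ne_zero ha)
    have h := Nat.gcd_mul_lcm a b
    have h1 : c = b' := by
      refine Nat.eq_of_mul_eq_mul_right hg ?_
      refine Nat.eq_of_mul_eq_mul_left (Nat.pos_of_ne_zero ha) ?_
      rw [← hb', ← h, hc]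
      ring
    have h2 : d = a' := by
      refine Nat.eq_of_mul_eq_mul_right hg ?_
      refine Nat.eq_of_mul_eq_mul_left (Nat.pos_of_ne_zero hb) ?_
      rw [← ha', mul_comm b a, ← h, hd]
      ring
    rw [h1, h2]
    exact hco.symm
  have hz : ∀ z : ℂ, z ≠ 0 → z ^ c ∈ kummerField Γ a → z ^ d ∈ kummerField Γ b →
      z ∈ kummerField Γ a ⊔ kummerField Γ b := by
    intro z hz0 h1 h2
    have h3 : z = (z ^ c) ^ c.gcdA d * (z ^ d) ^ c.gcdB d := by
      have := Nat.gcd_eq_gcd_ab c d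
      rw [hcd.gcd_eq_one] at this
      rw [← zpow_natCast z c, ← zpow_natCast z d, ← zpow_mul, ← zpow_mul, ← zpow_add₀ hz0, ← this]
      simp
    rw [h3]
    exact mul_mem (zpow_mem ((le_sup_left : kummerField Γ a ≤ _) h1) _)
      (zpow_mem ((le_sup_right : kummerField Γ b ≤ _) h2) _)
  refine adjoin_le_iff.2 ?_
  rintro z (h | ⟨g, hg, h⟩)
  · have h' : z ^ a.lcm b = 1 := h
    refine hz z (by rintro rfl; simp [hl] at h') (subset_adjoin _ _ (Or.inl ?_))
      (subset_adjoin _ _ (Or.inl ?_))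
    · rw [Set.mem_ofPred_eq, ← pow_mul, mul_comm, ← hc, h']
    · rw [Set.mem_ofPred_eq, ← pow_mul, mul_comm, ← hd, h']
  · refine hz z ?_ (subset_adjoin _ _ (Or.inr ⟨g, hg, ?_⟩))
      (subset_adjoin _ _ (Or.inr ⟨g, hg, ?_⟩))
    · rintro rfl
      rw [zero_pow hl] at h
      exact g.ne_zero (by exact_mod_cast h.symm)
    · rw [← pow_mul, mul_comm, ← hc, h]
    · rw [← pow_mul, mul_comm, ← hd, h]

/-- The averaging principle: if `card (H k) = card G / D k` and the `k` with `σ ∈ H k` are the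
divisors of an integer depending on `σ`, then the weighted sum of `1 / D k` is an average
of reciprocals of positive integers. -/
theorem le_sum_invWeight_div {G : Type*} [Fintype G] [Nonempty G] {M k₀ : ℕ} (hM : M ≠ 0)
    (hk₀ : k₀ ∣ M) (H : ℕ → Set G) (D : ℕ → ℕ)
    (hD : ∀ k, k ∣ M → Nat.card (H k) * D k = Nat.card G)
    (hH : ∀ σ, ∃ i, i ∣ M ∧ ∀ k, k ∣ M → (σ ∈ H k ↔ k ∣ i)) :
    1 / (k₀ : ℝ) * (1 / (D k₀ : ℝ) -
      ∑ p ∈ M.primeFactors with k₀ * p ∣ M, 1 / (D (k₀ * p) : ℝ)) ≤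
      ∑ k ∈ M.divisors, invWeight k / (D k : ℝ) := by
  classical
  have hG : (0 : ℝ) < Nat.card G := by exact_mod_cast Nat.card_pos
  have hk0 : k₀ ≠ 0 := ne_zero_of_dvd_ne_zero hM hk₀
  have hk0' : (0 : ℝ) < k₀ := by exact_mod_cast Nat.pos_of_ne_zero hk0
  have hDinv : ∀ k, k ∣ M →
      1 / (D k : ℝ) = (∑ σ : G, if σ ∈ H k then (1 : ℝ) else 0) / Nat.card G := by
    intro k hk
    have h1 : (∑ σ : G, if σ ∈ H k then (1 : ℝ) else 0) = Nat.card (H k) := by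
      rw [Finset.sum_boole, Nat.card_eq_fintype_card, Fintype.card_subtype]
    have h2 : (Nat.card (H k) : ℝ) * D k = Nat.card G := by exact_mod_cast hD k hk
    have h3 : (D k : ℝ) ≠ 0 := by
      intro h
      rw [h, mul_zero] at h2
      exact hG.ne h2
    rw [h1, div_eq_div_iff h3 hG.ne', one_mul, h2]
  -- Pointwise the right side is `1/i`. The left side is `1/k₀` if `i = k₀`, and at most 0
  -- otherwise: a proper multiple `i` of `k₀` is divisible by some `k₀ p`.
  have hpt : ∀ σ : G, 1 / (k₀ : ℝ) * ((if σ ∈ H k₀ then (1 : ℝ) else 0) -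
      ∑ p ∈ M.primeFactors with k₀ * p ∣ M, if σ ∈ H (k₀ * p) then (1 : ℝ) else 0) ≤
      ∑ k ∈ M.divisors, invWeight k * if σ ∈ H k then (1 : ℝ) else 0 := by
    intro σ
    obtain ⟨i, hiM, hi⟩ := hH σ
    have hi0 : i ≠ 0 := ne_zero_of_dvd_ne_zero hM hiM
    have hsum : ∑ k ∈ M.divisors, invWeight k * (if σ ∈ H k then (1 : ℝ) else 0) = 1 / i := by
      rw [← sum_divisors_invWeight hi0]
      simp only [mul_ite, mul_one, mul_zero]
      rw [← Finset.sum_filter]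
      refine Finset.sum_congr ?_ fun _ _ => rfl
      ext k
      simp only [Finset.mem_filter, Nat.mem_divisors]
      constructor
      · rintro ⟨⟨h1, -⟩, h2⟩
        exact ⟨(hi k h1).1 h2, hi0⟩
      · rintro ⟨h1, -⟩
        exact ⟨⟨h1.trans hiM, hM⟩, (hi k (h1.trans hiM)).2 h1⟩
    rw [hsum]
    have hnonneg : ∀ p ∈ M.primeFactors.filter (fun p => k₀ * p ∣ M),
        (0 : ℝ) ≤ if σ ∈ H (k₀ * p) then (1 : ℝ) else 0 := fun p _ => by split_ifs <;> simp
    have hS := Finset.sum_nonneg hnonneg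
    have hipos : (0 : ℝ) < i := by exact_mod_cast Nat.pos_of_ne_zero hi0
    by_cases hki : k₀ ∣ i
    · rw [if_pos ((hi _ hk₀).2 hki)]
      obtain ⟨t, rfl⟩ := hki
      by_cases ht : t = 1
      · subst ht
        rw [mul_one]
        have := one_div_pos.2 hk0'
        nlinarith
      · obtain ⟨p, hp, hpt⟩ := Nat.exists_prime_and_dvd ht
        have h1 : k₀ * p ∣ k₀ * t := mul_dvd_mul_left _ hpt
        have h2 : k₀ * p ∣ M := h1.trans hiM
        have h3 := Finset.single_le_sum hnonneg (Finset.mem_filter.2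
          ⟨Nat.mem_primeFactors.2 ⟨hp, (dvd_mul_left _ _).trans h2, hM⟩, h2⟩)
        rw [if_pos ((hi _ h2).2 h1)] at h3
        have := one_div_pos.2 hk0'
        have := one_div_pos.2 hipos
        nlinarith
    · rw [if_neg (fun h => hki ((hi _ hk₀).1 h))]
      have := one_div_pos.2 hk0'
      have := one_div_pos.2 hipos
      nlinarith
  have hsumσ := Finset.sum_le_sum fun σ (_ : σ ∈ Finset.univ) => hpt σ
  rw [← Finset.mul_sum, Finset.sum_sub_distrib, Finset.sum_comm,
    Finset.sum_comm (s := Finset.univ) (t := M.divisors)] at hsumσ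
  have hl : ∑ p ∈ M.primeFactors with k₀ * p ∣ M, 1 / (D (k₀ * p) : ℝ) =
      (∑ p ∈ M.primeFactors with k₀ * p ∣ M,
        ∑ σ : G, if σ ∈ H (k₀ * p) then (1 : ℝ) else 0) / Nat.card G := by
    rw [Finset.sum_div]
    exact Finset.sum_congr rfl fun p hp => hDinv _ (Finset.mem_filter.1 hp).2
  have hrr : ∑ k ∈ M.divisors, invWeight k / (D k : ℝ) =
      (∑ k ∈ M.divisors, ∑ σ : G, invWeight k * if σ ∈ H k then (1 : ℝ) else 0) /
        Nat.card G := by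
    rw [Finset.sum_div]
    refine Finset.sum_congr rfl fun k hk => ?_
    rw [← Finset.mul_sum, mul_div_assoc, ← hDinv _ (Nat.dvd_of_mem_divisors hk)]
    ring
  rw [hl, hrr, hDinv _ hk₀, ← sub_div, ← mul_div_assoc]
  exact div_le_div_of_nonneg_right hsumσ hG.le

theorem le_sum_divisors_invWeight_div_finrank {F L : Type*} [Field F] [Field L] [Algebra F L]
    (K : ℕ → IntermediateField F L) {M k₀ : ℕ} (hM : M ≠ 0) (hk₀ : k₀ ∣ M)
    (hone : K 1 = ⊥) (hmono : ∀ a b, b ≠ 0 → a ∣ b → K a ≤ K b)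
    (hlcm : ∀ a b, a ≠ 0 → b ≠ 0 → K (a.lcm b) ≤ K a ⊔ K b)
    (_ : FiniteDimensional F (K M)) (_ : IsGalois F (K M)) :
    1 / (k₀ : ℝ) * (1 / (Module.finrank F (K k₀) : ℝ) -
      ∑ p ∈ M.primeFactors with k₀ * p ∣ M, 1 / (Module.finrank F (K (k₀ * p)) : ℝ)) ≤
      ∑ k ∈ M.divisors, invWeight k / (Module.finrank F (K k) : ℝ) := by
  classical
  let R : ℕ → IntermediateField F (K M) := fun k => comap (K M).val (K k)
  have hfix : ∀ (k : ℕ) (σ : Gal(K M/F)), σ ∈ (R k).fixingSubgroup ↔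
      ∀ x : K M, (x : L) ∈ K k → σ x = x := fun k σ => mem_fixingSubgroup_iff (R k) σ
  have hR : ∀ k (hk : k ∣ M), R k = restrict (hmono k M hM hk) := fun k hk =>
    SetLike.ext fun x => (mem_restrict _ x).symm
  have hRle : ∀ a b, b ≠ 0 → a ∣ b → (R b).fixingSubgroup ≤ (R a).fixingSubgroup :=
    fun a b hb hab σ hσ => (hfix a σ).2 fun x hx => (hfix b σ).1 hσ x (hmono a b hb hab hx)
  refine le_sum_invWeight_div (G := Gal(K M/F)) hM hk₀
    (fun k => ((R k).fixingSubgroup : Set Gal(K M/F))) (fun k => Module.finrank F (K k))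
    (fun k hk => ?_) (fun σ => ?_)
  · have h1 : Module.finrank F (K k) = (R k).fixingSubgroup.index := by
      rw [← finrank_eq_fixingSubgroup_index]
      rw [hR k hk]
      exact (restrictAlgEquiv (hmono k M hM hk)).toLinearEquiv.finrank_eq
    rw [h1]
    exact Subgroup.card_mul_index _
  · have hex : (M.divisors.filter fun k => σ ∈ (R k).fixingSubgroup).Nonempty := by
      refine ⟨1, Finset.mem_filter.2 ⟨Nat.one_mem_divisors.2 hM, (hfix 1 σ).2 fun x hx => ?_⟩⟩
      rw [hone] at hx
      obtain ⟨y, hy⟩ := mem_bot.1 hx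
      have : x = algebraMap F (K M) y := Subtype.ext hy.symm
      rw [this, AlgEquiv.commutes]
    -- The `k` whose field is fixed by `σ` are closed under lcm, so the largest is a multiple of all
    -- the others.
    obtain ⟨i, hi, hmax⟩ := Finset.exists_max_image _ id hex
    obtain ⟨hiM, hiσ⟩ := Finset.mem_filter.1 hi
    have hiM := Nat.dvd_of_mem_divisors hiM
    have hi0 : i ≠ 0 := ne_zero_of_dvd_ne_zero hM hiM
    refine ⟨i, hiM, fun k hk => ⟨fun hσ => ?_, fun hki => hRle k i hi0 hki hiσ⟩⟩
    have hk0 : k ≠ 0 := ne_zero_of_dvd_ne_zero hM hk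
    have hl : σ ∈ (R (k.lcm i)).fixingSubgroup := by
      have h1 : (R k ⊔ R i).fixingSubgroup ≤ (R (k.lcm i)).fixingSubgroup := by
        refine fixingSubgroup_antitone ?_
        intro x hx
        have h2 : (x : L) ∈ K k ⊔ K i := hlcm k i hk0 hi0 hx
        have h3 : K k ⊔ K i = lift (R k ⊔ R i) := by
          rw [lift_sup, hR k hk, hR i hiM, lift_restrict, lift_restrict]
        rw [h3] at h2
        exact (mem_lift x).1 h2
      rw [fixingSubgroup_sup] at h1
      exact h1 ⟨hσ, hiσ⟩
    have h2 := hmax (k.lcm i) (Finset.mem_filter.2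
      ⟨Nat.mem_divisors.2 ⟨Nat.lcm_dvd hk hiM, hM⟩, hl⟩)
    have h3 : k.lcm i = i := le_antisymm h2
      (Nat.le_of_dvd (Nat.pos_of_ne_zero (Nat.lcm_ne_zero hk0 hi0)) (Nat.dvd_lcm_right k i))
    exact h3 ▸ Nat.dvd_lcm_left k i

theorem kummerField_one {Γ : Subgroup ℚˣ} : kummerField Γ 1 = ⊥ := by
  refine le_antisymm (adjoin_le_iff.2 ?_) bot_le
  rintro z (h | ⟨g, -, h⟩)
  · rw [Set.mem_ofPred_eq, pow_one] at h
    exact h ▸ one_mem _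
  · rw [pow_one] at h
    exact mem_bot.2 ⟨g, by simpa using h.symm⟩

theorem le_sum_divisors_kummerField {Γ : Subgroup ℚˣ} {M k₀ : ℕ} (hM : M ≠ 0) (hk₀ : k₀ ∣ M)
    (hfin : Module.finrank ℚ (kummerField Γ M) ≠ 0) :
    1 / (k₀ : ℝ) * (1 / (Module.finrank ℚ (kummerField Γ k₀) : ℝ) -
      ∑ p ∈ M.primeFactors with k₀ * p ∣ M,
        1 / (Module.finrank ℚ (kummerField Γ (k₀ * p)) : ℝ)) ≤
      ∑ k ∈ M.divisors, invWeight k / (Module.finrank ℚ (kummerField Γ k) : ℝ) := by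
  exact le_sum_divisors_invWeight_div_finrank (kummerField Γ) hM hk₀ kummerField_one
    (fun a b => kummerField_mono) (fun a b => kummerField_lcm_le)
    (Module.finite_of_finrank_pos (Nat.pos_of_ne_zero hfin)) (isGalois_kummerField hM)

theorem seriesTerm_one_eq_invWeight_div (Γ : Subgroup ℚˣ) (k : ℕ+) :
    seriesTerm Γ 1 k = invWeight k / (Module.finrank ℚ (kummerField Γ k) : ℝ) := by
  rw [seriesTerm, mul_assoc, jordanTotient_one, rad_mul_neg_one_pow, invWeight, div_div]

/-! ### Nonvanishing: a lower bound uniform in `M` -/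

/-- A uniform bound for the sum over primes `p` of the reciprocals of the relative degrees. -/
theorem sum_prime_weight_le (s : Finset ℕ) (hs : ∀ p ∈ s, p.Prime) :
    ∑ p ∈ s, (if p = 2 then (1 / 4 : ℝ) else 1 / ((p : ℝ) * (p - 1))) ≤ 3 / 4 := by
  let w : ℕ → ℝ := fun n =>
    if n < 2 then 0 else if n = 2 then 1 / 4 else 1 / ((n : ℝ) * (n - 1))
  have hw0 : ∀ n, 0 ≤ w n := by
    intro n
    simp only [w]
    split_ifs with h1 h2
    · rfl
    · norm_num
    · have : (2 : ℝ) ≤ n := by exact_mod_cast (not_lt.1 h1)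
      have : (0 : ℝ) < n * (n - 1) := by nlinarith
      positivity
  -- Summing over all integers `n ≥ 3` telescopes to at most `1/2`; with `1/4` for `n = 2` this
  -- gives `3/4`.
  have hrange : ∀ m : ℕ, ∑ n ∈ Finset.range (m + 3), w n = 3 / 4 - 1 / ((m : ℝ) + 2) := by
    intro m
    induction m with
    | zero => simp [Finset.sum_range_succ, w]; norm_num
    | succ m ih =>
      rw [Finset.sum_range_succ, ih]
      have : w (m + 3) = 1 / (((m : ℝ) + 3) * (m + 2)) := by
        simp only [w]
        rw [if_neg (by omega), if_neg (by omega)]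
        push_cast
        ring_nf
      rw [this]
      push_cast
      field_simp
      ring
  have h1 : ∑ p ∈ s, (if p = 2 then (1 / 4 : ℝ) else 1 / ((p : ℝ) * (p - 1))) = ∑ p ∈ s, w p :=
    Finset.sum_congr rfl fun p hp => by
      simp only [w]
      rw [if_neg (not_lt.2 (hs p hp).two_le)]
  have h2 : ∑ p ∈ s, w p ≤ ∑ n ∈ Finset.range (s.sup id + 3), w n := by
    refine Finset.sum_le_sum_of_subset_of_nonneg (fun p hp => ?_) fun n _ _ => hw0 n
    have := Finset.le_sup (f := id) hp
    simp only [id] at this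
    exact Finset.mem_range.2 (by omega)
  rw [h1]
  refine h2.trans ?_
  rw [hrange]
  have : (0 : ℝ) < 1 / (((s.sup id : ℕ) : ℝ) + 2) := by positivity
  linarith

/-- Both levels have gcd `N` with `N`, so `I N` cancels from the ratio of degrees. Level `2N` rather
than `N` makes `φ` double at `p = 2`, giving `1/4` instead of `1/2`; with `1/2` the telescoping
bound would reach 1 and be useless. -/
theorem one_div_finrank_mul_prime_le {Γ : Subgroup ℚˣ} {N r : ℕ} (hr : 1 ≤ r) (hN : N ≠ 0)
    {I : ℕ → ℕ} (hI0 : ∀ d ≠ 0, I d ≠ 0)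
    (hI : ∀ k ≠ 0, Module.finrank ℚ (kummerField Γ k) =
      k.totient * ((k / k.gcd N) ^ r * I (k.gcd N))) {p : ℕ} (hp : p.Prime) :
    1 / (Module.finrank ℚ (kummerField Γ (2 * N * p)) : ℝ) ≤
      1 / (Module.finrank ℚ (kummerField Γ (2 * N)) : ℝ) *
        (if p = 2 then (1 / 4 : ℝ) else 1 / ((p : ℝ) * (p - 1))) := by
  have hNpos := Nat.pos_of_ne_zero hN
  have h2N : 2 * N ≠ 0 := by positivity
  have h2Np : 2 * N * p ≠ 0 := mul_ne_zero h2N hp.ne_zero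
  have hφ : 0 < (2 * N).totient := Nat.totient_pos.2 (Nat.pos_of_ne_zero h2N)
  have hIN := Nat.pos_of_ne_zero (hI0 N hN)
  have hg1 : (2 * N).gcd N = N := Nat.gcd_eq_right (dvd_mul_left N 2)
  have hg2 : (2 * N * p).gcd N = N := Nat.gcd_eq_right ⟨2 * p, by ring⟩
  have hd2 : 2 * N * p / N = 2 * p := Nat.div_eq_of_eq_mul_left hNpos (by ring)
  have e1 : Module.finrank ℚ (kummerField Γ (2 * N)) = (2 * N).totient * (2 ^ r * I N) := by
    rw [hI _ h2N, hg1, Nat.mul_div_cancel _ hNpos]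
  have e2 : Module.finrank ℚ (kummerField Γ (2 * N * p)) =
      (2 * N * p).totient * p ^ r * (2 ^ r * I N) := by
    rw [hI _ h2Np, hg2, hd2, mul_pow]
    ring
  have hpr : p ≤ p ^ r := Nat.le_self_pow (by omega) p
  obtain ⟨c, hc0, hcw, hc⟩ : ∃ c : ℕ, 0 < c ∧
      (if p = 2 then (1 / 4 : ℝ) else 1 / ((p : ℝ) * (p - 1))) = 1 / c ∧
      (2 * N).totient * c ≤ (2 * N * p).totient * p ^ r := by
    by_cases h2 : p = 2
    · subst h2
      refine ⟨4, by norm_num, by norm_num, ?_⟩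
      rw [mul_comm (2 * N) 2, Nat.totient_mul_of_prime_of_dvd Nat.prime_two (dvd_mul_right 2 N)]
      nlinarith
    · refine ⟨p * (p - 1), Nat.mul_pos hp.pos (Nat.sub_pos_of_lt hp.one_lt), ?_, ?_⟩
      · rw [if_neg h2]
        push_cast [Nat.cast_sub hp.one_le]
        rfl
      · have h := Nat.totient_super_multiplicative (2 * N) p
        rw [Nat.totient_prime hp] at h
        calc (2 * N).totient * (p * (p - 1)) = (2 * N).totient * (p - 1) * p := by ring
          _ ≤ (2 * N * p).totient * p ^ r := Nat.mul_le_mul h hpr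
  rw [hcw, one_div_mul_one_div]
  have hpos : 0 < Module.finrank ℚ (kummerField Γ (2 * N)) := by rw [e1]; positivity
  refine one_div_le_one_div_of_le (by positivity) ?_
  have : Module.finrank ℚ (kummerField Γ (2 * N)) * c ≤
      Module.finrank ℚ (kummerField Γ (2 * N * p)) := by
    rw [e1, e2]
    calc (2 * N).totient * (2 ^ r * I N) * c = (2 * N).totient * c * (2 ^ r * I N) := by ring
      _ ≤ _ := Nat.mul_le_mul_right _ hc
  exact_mod_cast this

theorem tsum_invWeight_div_finrank_pos {Γ : Subgroup ℚˣ} {N r : ℕ} (hr : 1 ≤ r) (hN : N ≠ 0)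
    {I : ℕ → ℕ} (hI0 : ∀ d ≠ 0, I d ≠ 0)
    (hI : ∀ k ≠ 0, Module.finrank ℚ (kummerField Γ k) =
      k.totient * ((k / k.gcd N) ^ r * I (k.gcd N)))
    (hs : Summable fun k : ℕ => invWeight k / (Module.finrank ℚ (kummerField Γ k) : ℝ)) :
    0 < ∑' k : ℕ, invWeight k / (Module.finrank ℚ (kummerField Γ k) : ℝ) := by
  have hfin : ∀ k ≠ 0, Module.finrank ℚ (kummerField Γ k) ≠ 0 := by
    intro k hk
    have hkp := Nat.pos_of_ne_zero hk
    have h1 := Nat.totient_pos.2 hkp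
    have h2 : 0 < k / k.gcd N := Nat.div_pos (Nat.gcd_le_left N hkp) (Nat.gcd_pos_of_pos_left N hkp)
    have h3 := hI0 _ (Nat.gcd_ne_zero_left (n := N) hk)
    rw [hI k hk]
    positivity
  have h2N : 2 * N ≠ 0 := by have := Nat.pos_of_ne_zero hN; positivity
  set D : ℝ := (Module.finrank ℚ (kummerField Γ (2 * N)) : ℝ)
  have hD : 0 < D := by
    have := Nat.pos_of_ne_zero (hfin _ h2N)
    simp only [D]
    positivity
  have h2N' : (0 : ℝ) < (2 * N : ℕ) := by exact_mod_cast Nat.pos_of_ne_zero h2N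
  have hpos : 0 < 1 / ((2 * N : ℕ) : ℝ) * (1 / D * (1 / 4)) := by positivity
  refine hpos.trans_le ?_
  have hbound : ∀ M ≠ 0, 2 * N ∣ M → 1 / ((2 * N : ℕ) : ℝ) * (1 / D * (1 / 4)) ≤
      ∑ k ∈ M.divisors, invWeight k / (Module.finrank ℚ (kummerField Γ k) : ℝ) := by
    intro M hM hd
    refine le_trans ?_ (le_sum_divisors_kummerField hM hd (hfin M hM))
    refine mul_le_mul_of_nonneg_left ?_ (by positivity)
    have h1 : ∑ p ∈ M.primeFactors with 2 * N * p ∣ M,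
        1 / (Module.finrank ℚ (kummerField Γ (2 * N * p)) : ℝ) ≤ 1 / D * (3 / 4) := by
      have hprime : ∀ p ∈ M.primeFactors.filter (fun p => 2 * N * p ∣ M), p.Prime := fun p hp =>
        Nat.prime_of_mem_primeFactors (Finset.mem_filter.1 hp).1
      refine (Finset.sum_le_sum fun p hp =>
        one_div_finrank_mul_prime_le hr hN hI0 hI (hprime p hp)).trans ?_
      rw [← Finset.mul_sum]
      exact mul_le_mul_of_nonneg_left (sum_prime_weight_le _ hprime) (by positivity)
    linarith
  -- Divisor sets of `2N · n!`, with 0 adjoined, are cofinal among finite sets; the term at 0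
  -- vanishes.
  refine ge_of_tendsto_of_frequently hs.hasSum (Filter.frequently_atTop.2 fun s => ?_)
  have hM : 2 * N * (s.sup id).factorial ≠ 0 := mul_ne_zero h2N (Nat.factorial_ne_zero _)
  refine ⟨insert 0 (2 * N * (s.sup id).factorial).divisors, fun k hk => ?_, ?_⟩
  · rcases Nat.eq_zero_or_pos k with rfl | hk0
    · exact Finset.mem_insert_self _ _
    · have h1 : k ≤ s.sup id := Finset.le_sup (f := id) hk
      exact Finset.mem_insert_of_mem (Nat.mem_divisors.2
        ⟨(Nat.dvd_factorial hk0 h1).mul_left _, hM⟩)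
  · rw [Finset.sum_insert fun h => Nat.lt_irrefl 0 (Nat.pos_of_mem_divisors h)]
    have := hbound _ hM (dvd_mul_right _ _)
    simpa [invWeight] using this

end KummerAverage

theorem corollary4 (Γ : Subgroup ℚˣ) (hfg : Γ.FG) (hpos : ∀ g ∈ Γ, 0 < (g : ℚ))
    (r : ℕ) (hr : 1 ≤ r) (hrank : Module.finrank ℤ (Additive Γ) = r) :
    Summable (fun k : ℕ+ => KummerAverage.seriesTerm Γ 1 k) ∧
    Multipliable (fun p : Nat.Primes => KummerAverage.eulerFactor r p) ∧
    ∃ q : ℚ, q ≠ 0 ∧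
      KummerAverage.constC Γ 1 = (q : ℝ) * KummerAverage.constEuler r := by
  open KummerAverage in
  obtain ⟨N, hN, I, hI0, hI⟩ := exists_finrank_kummerField_eq hfg hpos
  rw [hrank] at hI
  have hprod := hasProd_eulerFactor hr
  obtain ⟨hsum, q, hq⟩ := tsum_radTerm_mul_gcd hr hN fun d => (d : ℚ) ^ r / I d
  have hterm : ∀ k : ℕ+, radTerm r k * (((((k : ℕ).gcd N : ℕ) : ℚ) ^ r / I ((k : ℕ).gcd N) : ℚ) : ℝ)
      = seriesTerm Γ 1 k := fun k => by
    rw [seriesTerm_eq hI k]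
    push_cast
    rfl
  have hweight : ∀ k : ℕ, radTerm r k * ((((k.gcd N : ℕ) : ℚ) ^ r / I (k.gcd N) : ℚ) : ℝ) =
      invWeight k / (Module.finrank ℚ (kummerField Γ k) : ℝ) := by
    intro k
    rcases Nat.eq_zero_or_pos k with rfl | hk
    · simp [radTerm_zero, invWeight]
    · exact (hterm ⟨k, hk⟩).trans (seriesTerm_one_eq_invWeight_div Γ ⟨k, hk⟩)
  have hC : constC Γ 1 =
      ∑' k : ℕ, radTerm r k * ((((k.gcd N : ℕ) : ℚ) ^ r / I (k.gcd N) : ℚ) : ℝ) := by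
    rw [← tsum_zero_pnat_eq_tsum_nat hsum, radTerm_zero, zero_mul, zero_add, constC]
    exact tsum_congr fun k => (hterm k).symm
  refine ⟨?_, hprod.multipliable, q, ?_, ?_⟩
  · have := hsum.comp_injective PNat.coe_injective
    exact this.congr fun k => hterm k
  -- `q = 0` would make the series vanish, against its positivity.
  · rintro rfl
    have hs' := hsum
    simp only [hweight] at hs' hq
    have := tsum_invWeight_div_finrank_pos hr hN hI0 hI hs'
    rw [hq] at this
    simp at this
  · rw [hC, hq, constEuler, hprod.tprod_eq]
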